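/- Let $k$ be a perfect field of characteristic $p>0$, and let $S$ be an affine monoid, i.e. a finitely generated submonoid of some $\mathbb Z^n$. Put $M=\mathbb ZS$ and $C=\mathbb R_{\ge 0}S$, and assume that the cone $C$ is pointed (contains no line). For a face $D$ of $C$ (the cone $C$ itself counts as a face) let $\langle D\rangle$ be its real linear span and $M_D=\mathbb Z(S\cap D)$. Assume that $S$ is seminormal: $S\cap\operatorname{int}(D)=M_D\cap\operatorname{int}(D)$ for every face $D$ of $C$, where $\operatorname{int}$ is the relative interior. Let $R=k[S]$ be the monoid algebra, with monomials $x^u$, $u\in S$. A proper face $D\subsetneq C$ is a proper RUF (relatively unsaturated face) if $M_D\neq\bigcap_{D'\supsetneq D}(M_{D'}\cap\langle D\rangle)$, the intersection being over all faces $D'$ of $C$ strictly containing $D$; by convention $C$ is also a RUF, but not a proper one. A face $D$ is a $p$-face if $p$ divides the index $[M\cap\langle D\rangle:M_D]$. A pRUF is a RUF that is a $p$-face, and a maximal pRUF is one not properly contained in another pRUF. An ideal $I\subseteq R$ is $\mathcal C$-fixed (fixed by the Cartier algebra $\mathcal C=\bigoplus_{e\ge 0}\operatorname{Hom}_R(F^e_*R,R)$,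 where $F^e_*R$ is $R$ with $r\in R$ acting as multiplication by $r^{p^e}$) if $$I=\sum_{e>0}\ \sum_{\phi\in\operatorname{Hom}_R(F^e_*R,R)}\phi(F^e_*I).$$ Then every $\mathcal C$-fixed ideal of $R$ is monomial, and the $\mathcal C$-fixed ideals of $R$ are precisely the ideals of the form $$I_{D_1\cup\dots\cup D_m}=\big\langle x^u \;\big|\; u\in S\setminus(D_1\cup\dots\cup D_m)\big\rangle$$ for finitely many ($m\ge 0$) faces $D_1,\dots,D_m$ of $C$ such that (1) each $D_i$ is an intersection of proper RUFs of $C$ (the empty intersection being $C$), and (2) every maximal pRUF appears as one of the $D_i$. -/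

import Mathlib

/-! ### Lattices, cones and faces attached to a submonoid of `ℤⁿ` -/

namespace MonoidCone

/-- The inclusion `ℤⁿ → ℝⁿ`. -/
def toReal (n : ℕ) : (Fin n → ℤ) →+ (Fin n → ℝ) :=
  (Int.castAddHom ℝ).compLeft (Fin n)

variable {n : ℕ} (S : AddSubmonoid (Fin n → ℤ))

/-- The lattice `M = ℤS` generated by `S`. -/
def lattice : AddSubgroup (Fin n → ℤ) :=
  AddSubgroup.closure (S : Set (Fin n → ℤ))

/-- The cone `C(S) = ℝ₊ S`. -/
def cone : PointedCone ℝ (Fin n → ℝ) :=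
  PointedCone.hull ℝ (toReal n '' (S : Set (Fin n → ℤ)))

/-- The cone `C(S)` is pointed in the sense of convex geometry: it contains no line. -/
def IsPositive : Prop :=
  ((cone S : PointedCone ℝ (Fin n → ℝ)) : ConvexCone ℝ (Fin n → ℝ)).Salient

/-- `D` is a face of `C(S)`; the cone itself counts as a face. -/
def IsFace (D : PointedCone ℝ (Fin n → ℝ)) : Prop :=
  D.IsFaceOf (cone S)

/-- The lattice `M_D = ℤ(S ∩ D)` generated by the elements of `S` on `D`. -/
def faceLattice (D : PointedCone ℝ (Fin n → ℝ)) : AddSubgroup (Fin n → ℤ) :=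
  AddSubgroup.closure {u | u ∈ S ∧ toReal n u ∈ D}

/-- The lattice points `{u ∈ ℤⁿ | u ∈ ⟨D⟩}` on the real linear span `⟨D⟩` of `D`. -/
def spanPoints (D : PointedCone ℝ (Fin n → ℝ)) : AddSubgroup (Fin n → ℤ) :=
  (Submodule.span ℝ (D : Set (Fin n → ℝ))).toAddSubgroup.comap (toReal n)

/-- `S` is seminormal: `S ∩ int(D) = M_D ∩ int(D)` for every face `D` of `C(S)`, where `int(D)` is
the relative interior. -/
def IsSeminormal : Prop :=
  ∀ D : PointedCone ℝ (Fin n → ℝ), IsFace S D →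
    ∀ u : Fin n → ℤ, toReal n u ∈ intrinsicInterior ℝ (D : Set (Fin n → ℝ)) →
      (u ∈ S ↔ u ∈ faceLattice S D)

/-- `D` is relatively saturated: `M_D` is the intersection of the groups `M_{D'} ∩ ⟨D⟩` over all
faces `D'` strictly containing `D`. -/
def IsRelativelySaturated (D : PointedCone ℝ (Fin n → ℝ)) : Prop :=
  faceLattice S D =
    ⨅ (D' : PointedCone ℝ (Fin n → ℝ)) (_ : IsFace S D') (_ : D < D'),
      faceLattice S D' ⊓ spanPoints D

/-- A relatively unsaturated face; by convention the whole cone is one. -/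
def IsRUF (D : PointedCone ℝ (Fin n → ℝ)) : Prop :=
  IsFace S D ∧ (D = cone S ∨ ¬ IsRelativelySaturated S D)

/-- A relatively unsaturated face other than the whole cone. -/
def IsProperRUF (D : PointedCone ℝ (Fin n → ℝ)) : Prop :=
  IsRUF S D ∧ D ≠ cone S

/-- A `p`-face: a face `D` such that `p` divides the index `[M ∩ ⟨D⟩ : M_D]`. -/
def IsPFace (p : ℕ) (D : PointedCone ℝ (Fin n → ℝ)) : Prop :=
  IsFace S D ∧ p ∣ (faceLattice S D).relIndex (lattice S ⊓ spanPoints D)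

/-- A `p`-face that is relatively unsaturated. -/
def IsPRUF (p : ℕ) (D : PointedCone ℝ (Fin n → ℝ)) : Prop :=
  IsRUF S D ∧ IsPFace S p D

/-- A pRUF that is not properly contained in another pRUF. -/
def IsMaximalPRUF (p : ℕ) (D : PointedCone ℝ (Fin n → ℝ)) : Prop :=
  Maximal (IsPRUF S p) D

/-- `D` is an intersection of proper RUFs; the intersection of no faces of `C(S)` is `C(S)`. -/
def IsIntersectionOfProperRUFs (D : PointedCone ℝ (Fin n → ℝ)) : Prop :=
  ∃ T : Set (PointedCone ℝ (Fin n → ℝ)), (∀ E ∈ T, IsProperRUF S E) ∧ D = cone S ⊓ sInf T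

/-- The ideal `I_{D_1 ∪ ⋯ ∪ D_m}` of `k[S]`, generated by the monomials `x^u` with
`u ∈ S` outside all `D_i`. -/
noncomputable def unionIdeal (k : Type*) [Field k] {m : ℕ} (D : Fin m → PointedCone ℝ (Fin n → ℝ)) :
    Ideal (AddMonoidAlgebra k S) :=
  Ideal.span {f | ∃ u : S, (∀ i, toReal n (u : Fin n → ℤ) ∉ D i) ∧
    f = AddMonoidAlgebra.single u (1 : k)}

/-- A monomial ideal of `k[S]`: an ideal generated by monomials `x^u`. -/
def IsMonomialIdeal {k : Type*} [Field k] (I : Ideal (AddMonoidAlgebra k S)) : Prop :=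
  ∃ U : Set S, I = Ideal.span ((fun u : S => AddMonoidAlgebra.single u (1 : k)) '' U)

/-- A monoid algebra over a field of characteristic `p` has characteristic `p`. -/
instance charP_monoidAlgebra (k : Type*) [Field k] (p : ℕ) [CharP k p] :
    CharP (AddMonoidAlgebra k S) p :=
  charP_of_injective_algebraMap (algebraMap k (AddMonoidAlgebra k S)).injective p

end MonoidCone

/-! ### `p⁻ᵉ`-linear maps and ideals fixed by the Cartier algebra -/

namespace Cartier

/-- The module `F^e_* R`: the additive group of `R`, with `r ∈ R` acting as
multiplication by `r ^ (p ^ e)`. -/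
def FrobeniusPush (_p _e : ℕ) (R : Type*) : Type _ := R

section

variable (p e : ℕ) [Fact p.Prime] (R : Type*) [CommRing R] [CharP R p]

instance : AddCommGroup (FrobeniusPush p e R) :=
  inferInstanceAs (AddCommGroup R)

instance : Module R (FrobeniusPush p e R) :=
  Module.compHom R (iterateFrobenius R p e)

/-- The scalar action on `F^e_* R` is multiplication by `p ^ e`-th powers. -/
theorem frobeniusPush_smul_def (r x : R) :
    (r • (show FrobeniusPush p e R from x) : FrobeniusPush p e R) = (r ^ p ^ e * x : R) :=
  rfl

/-- The submodule `F^e_* I` of `F^e_* R` for an ideal `I` of `R`. -/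
def pushIdeal {R : Type*} [CommRing R] [CharP R p] (I : Ideal R) :
    Submodule R (FrobeniusPush p e R) where
  carrier := {x | (show R from x) ∈ I}
  add_mem' := fun ha hb => I.add_mem ha hb
  zero_mem' := I.zero_mem
  smul_mem' := fun r _ hx => I.mul_mem_left (r ^ p ^ e) hx

end

/-- `I` is fixed by the Cartier algebra `⨁ₑ Hom_R(F^e_* R, R)`:
`I = ∑_{e > 0} ∑_{φ ∈ Hom_R(F^e_* R, R)} φ(F^e_* I)`. -/
def IsFixed (p : ℕ) [Fact p.Prime] {R : Type*} [CommRing R] [CharP R p] (I : Ideal R) : Prop :=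
  I = ⨆ (e : ℕ) (_ : 0 < e) (φ : FrobeniusPush p e R →ₗ[R] R), (pushIdeal p e I).map φ

end Cartier

namespace MonoidCone

variable {n : ℕ} {S : AddSubmonoid (Fin n → ℤ)}

/-! Everything is reduced to the relation `CartierRel S p e u v` on exponents: `u + p ^ e • z ∈ S`
forces `v + z ∈ S` for all `z` in the lattice `M`. If `x^v` occurs in `φ(c x^u)` for a `p⁻ᵉ`-linear
`φ`, comparing coefficients gives the relation (`cartierRel_of_coeff_single_ne_zero`). Conversely
the relation makes `c x^(u + pᵉ z) ↦ c^(1/pᵉ) x^(v + z)`, with all other monomials sent to zero, a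
`p⁻ᵉ`-linear map over a perfect field (`exists_linearMap_of_cartierRel`).

A fixed ideal is a sum of images with `e` arbitrarily large (`IsFixed.le_iSup`). Once `pᵉ` separates
the exponents of finitely many generators, homogeneous maps extract single terms, so the ideal is
monomial. Its exponent set is closed under the relation, and each member is related to from a
member.

For `e > 0` and seminormal `S`, a relation from `u` to `v` forces every proper RUF through `v` to
contain `u` and keeps `v` off every pRUF. Conversely, if `v` is on no `p`-face and every proper RUF
through `v` contains `u`, the relation holds for some `e > 0` (`exists_cartierRel`). Since every
`p`-face lies in a maximal pRUF, the exponents missing from a fixed ideal are those on the maximal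
pRUFs or on the RUF hulls of missing exponents. In the other direction, an exponent off all maximal
pRUFs is related to itself (`cartierRel_self`). -/

theorem toReal_apply (u : Fin n → ℤ) (i : Fin n) : toReal n u i = (u i : ℝ) := rfl

theorem toReal_mem_cone {u : Fin n → ℤ} (hu : u ∈ S) : toReal n u ∈ cone S :=
  Submodule.subset_span ⟨u, hu, rfl⟩

theorem isFace_cone : IsFace S (cone S) := PointedCone.IsFaceOf.refl _

/-! ### Minimal faces, relative interiors and face lattices -/

/-- The smallest face of `C(S)` containing a point `x` of `C(S)`. -/
def minFace (S : AddSubmonoid (Fin n → ℤ)) (x : Fin n → ℝ) : PointedCone ℝ (Fin n → ℝ) where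
  carrier := {y | y ∈ cone S ∧ ∃ r : ℝ, 0 ≤ r ∧ r • x - y ∈ cone S}
  zero_mem' := ⟨zero_mem _, 0, le_rfl, by simp⟩
  add_mem' := by
    rintro y y' ⟨hy, r, hr, h⟩ ⟨hy', r', hr', h'⟩
    refine ⟨add_mem hy hy', r + r', add_nonneg hr hr', ?_⟩
    convert add_mem h h' using 1
    rw [add_smul]; abel
  smul_mem' := by
    rintro c y ⟨hy, r, hr, h⟩
    refine ⟨Submodule.smul_mem _ c hy, c * r, mul_nonneg c.2 hr, ?_⟩
    convert Submodule.smul_mem _ c h using 1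
    rw [smul_sub, mul_smul]; rfl

theorem isFace_minFace (x : Fin n → ℝ) : IsFace S (minFace S x) where
  le := fun _ h => h.1
  mem_of_smul_add_mem := by
    rintro y y' a hy hy' ha ⟨-, r, hr, h⟩
    refine ⟨hy, r / a, by positivity, ?_⟩
    convert PointedCone.smul_mem (cone S) (inv_nonneg.2 ha.le) (add_mem h hy') using 1
    rw [show r • x - (a • y + y') + y' = r • x - a • y by abel, smul_sub, smul_smul, smul_smul,
      inv_mul_cancel₀ ha.ne', one_smul, div_eq_inv_mul]

theorem mem_minFace_self {x : Fin n → ℝ} (hx : x ∈ cone S) : x ∈ minFace S x :=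
  ⟨hx, 1, zero_le_one, by simp⟩

theorem minFace_le {D : PointedCone ℝ (Fin n → ℝ)} (hD : IsFace S D) {x : Fin n → ℝ}
    (hx : x ∈ D) : minFace S x ≤ D := by
  rintro y ⟨hy, r, hr, h⟩
  refine PointedCone.IsFaceOf.mem_of_add_mem_left hD hy h ?_
  rw [add_sub_cancel]
  exact D.smul_mem hr hx

/-- A point of a convex cone `D` that absorbs all of `D` lies in the relative interior of `D`. -/
theorem mem_intrinsicInterior_of_absorbing {D : PointedCone ℝ (Fin n → ℝ)} {y : Fin n → ℝ}
    (h : ∀ t ∈ D, ∃ r : ℝ, 0 < r ∧ r • y - t ∈ D) :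
    y ∈ intrinsicInterior ℝ (D : Set (Fin n → ℝ)) := by
  obtain ⟨t, ht⟩ : (intrinsicInterior ℝ (D : Set (Fin n → ℝ))).Nonempty :=
    Set.Nonempty.intrinsicInterior D.convex ⟨0, zero_mem D⟩
  obtain ⟨t', ht', rfl⟩ := ht
  have htD : (t' : Fin n → ℝ) ∈ D := interior_subset (s := ((↑) ⁻¹' (D : Set (Fin n → ℝ)) :
    Set (affineSpan ℝ (D : Set (Fin n → ℝ))))) ht'
  obtain ⟨r, hr, hd⟩ := h _ htD
  -- The affine map `x ↦ r • x - d` preserves the affine span and sends `y` to the interior point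
  -- `t'`. By `key` the preimage of `D` lies in `D`, so a neighbourhood of `t'` pulls back to one of
  -- `y`.
  set d := r • y - (t' : Fin n → ℝ) with hd_def
  have key : ∀ x, r • x - d ∈ D → x ∈ D := fun x hx => by
    have := D.smul_mem (inv_nonneg.2 hr.le) (add_mem hx hd)
    rwa [sub_add_cancel, smul_smul, inv_mul_cancel₀ hr.ne', one_smul] at this
  have hyD : y ∈ D := key y (by rw [hd_def, sub_sub_cancel]; exact htD)
  have hspan : ∀ x ∈ affineSpan ℝ (D : Set (Fin n → ℝ)),
      r • x - d ∈ affineSpan ℝ (D : Set (Fin n → ℝ)) := fun x hx => by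
    have := AffineSubspace.smul_vsub_vadd_mem _ r hx
      (subset_affineSpan ℝ (D : Set (Fin n → ℝ)) (D.smul_mem (inv_nonneg.2 hr.le) hd))
      (subset_affineSpan ℝ (D : Set (Fin n → ℝ)) (zero_mem D))
    simpa [smul_sub, smul_smul, mul_inv_cancel₀ hr.ne'] using this
  obtain ⟨V, hVD, hV, htV⟩ := mem_interior.1 ht'
  obtain ⟨U, hU, rfl⟩ := isOpen_induced_iff.1 hV
  refine ⟨⟨y, subset_affineSpan ℝ _ hyD⟩, ?_, rfl⟩
  refine mem_interior.2 ⟨(fun x : affineSpan ℝ (D : Set (Fin n → ℝ)) =>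
    r • (x : Fin n → ℝ) - d) ⁻¹' U, fun x hx => ?_, hU.preimage (by fun_prop), ?_⟩
  · exact key x (@hVD ⟨r • (x : Fin n → ℝ) - d, hspan x x.2⟩ hx)
  · change r • y - d ∈ U
    rw [hd_def, sub_sub_cancel]; exact htV

theorem mem_intrinsicInterior_minFace {y : Fin n → ℝ} (hy : y ∈ cone S) :
    y ∈ intrinsicInterior ℝ (minFace S y : Set (Fin n → ℝ)) := by
  refine mem_intrinsicInterior_of_absorbing fun t ht => ?_
  obtain ⟨htC, r, hr, h⟩ := ht
  have h1 : (r + 1) • y - t ∈ cone S := by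
    convert add_mem h hy using 1
    rw [add_smul, one_smul]; abel
  refine ⟨r + 1, by positivity, ?_⟩
  refine PointedCone.IsFaceOf.mem_of_add_mem_left (isFace_minFace y) h1 htC ?_
  rw [sub_add_cancel]
  exact PointedCone.smul_mem _ (by positivity) (mem_minFace_self hy)

theorem mem_faceLattice_of_mem {D : PointedCone ℝ (Fin n → ℝ)} {u : Fin n → ℤ} (hu : u ∈ S)
    (huD : toReal n u ∈ D) : u ∈ faceLattice S D :=
  AddSubgroup.subset_closure ⟨hu, huD⟩

theorem faceLattice_mono {D D' : PointedCone ℝ (Fin n → ℝ)} (h : D ≤ D') :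
    faceLattice S D ≤ faceLattice S D' :=
  AddSubgroup.closure_mono fun _ hu => ⟨hu.1, h hu.2⟩

theorem faceLattice_cone : faceLattice S (cone S) = lattice S := by
  unfold faceLattice lattice
  congr 1
  ext u
  exact ⟨fun h => h.1, fun h => ⟨h, toReal_mem_cone h⟩⟩

theorem faceLattice_le_lattice (D : PointedCone ℝ (Fin n → ℝ)) : faceLattice S D ≤ lattice S :=
  AddSubgroup.closure_mono fun _ hu => hu.1

theorem mem_spanPoints_of_mem {D : PointedCone ℝ (Fin n → ℝ)} {u : Fin n → ℤ}
    (h : toReal n u ∈ D) : u ∈ spanPoints D := Submodule.subset_span h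

theorem faceLattice_le_spanPoints (D : PointedCone ℝ (Fin n → ℝ)) :
    faceLattice S D ≤ spanPoints D :=
  (AddSubgroup.closure_le _).2 fun _ hu => mem_spanPoints_of_mem hu.2

/-- An element of the cone lies in a seminormal monoid as soon as it lies in the lattice of the
smallest face containing it. -/
theorem IsSeminormal.mem_of_mem_faceLattice (hsn : IsSeminormal S) {D : PointedCone ℝ (Fin n → ℝ)}
    {u : Fin n → ℤ} (huC : toReal n u ∈ cone S) (hD : D ≤ minFace S (toReal n u))
    (hu : u ∈ faceLattice S D) : u ∈ S :=
  (hsn _ (isFace_minFace _) u (mem_intrinsicInterior_minFace huC)).2 (faceLattice_mono hD hu)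

theorem toReal_nsmul_eq (m : ℕ) (u : Fin n → ℤ) : toReal n (m • u) = (m : ℝ) • toReal n u := by
  ext i; simp [toReal_apply]

/-! ### Finite generation of faces -/

theorem cone_eq_hull_of_closure {A : Set (Fin n → ℤ)} (hA : AddSubmonoid.closure A = S) :
    cone S = PointedCone.hull ℝ (toReal n '' A) := by
  apply le_antisymm
  · refine Submodule.span_le.2 ?_
    rintro _ ⟨u, hu, rfl⟩
    rw [← hA] at hu
    induction hu using AddSubmonoid.closure_induction with
    | mem x hx => exact Submodule.subset_span ⟨x, hx, rfl⟩
    | zero => rw [map_zero]; exact zero_mem _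
    | add x y _ _ hx hy => rw [map_add]; exact add_mem hx hy
  · refine Submodule.span_mono (Set.image_mono ?_)
    rw [← hA]; exact AddSubmonoid.subset_closure

/-- A face of a cone is generated by the generators of the cone that lie on it. -/
theorem IsFace.eq_hull {D : PointedCone ℝ (Fin n → ℝ)} (hD : IsFace S D) {A : Set (Fin n → ℤ)}
    (hA : AddSubmonoid.closure A = S) :
    D = PointedCone.hull ℝ (toReal n '' {u ∈ A | toReal n u ∈ D}) := by
  apply le_antisymm
  · intro x hx
    have hxC : x ∈ PointedCone.hull ℝ (toReal n '' A) := cone_eq_hull_of_closure hA ▸ hD.le hx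
    have hle : PointedCone.hull ℝ (toReal n '' A) ≤ cone S := (cone_eq_hull_of_closure hA).ge
    induction hxC using Submodule.span_induction with
    | mem x h =>
      obtain ⟨u, hu, rfl⟩ := h
      exact Submodule.subset_span ⟨u, ⟨hu, hx⟩, rfl⟩
    | zero => exact zero_mem _
    | add x y hx' hy' ihx ihy =>
      have h := (PointedCone.IsFaceOf.add_mem_iff_mem hD (hle hx') (hle hy')).1 hx
      exact add_mem (ihx h.1) (ihy h.2)
    | smul a x hx' ih =>
      rcases eq_or_ne a 0 with rfl | ha
      · rw [zero_smul]; exact zero_mem _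
      · refine Submodule.smul_mem _ a (ih ?_)
        refine hD.mem_of_smul_add_mem (a := (a : ℝ)) (y := 0) (hle hx') (zero_mem _)
          (lt_of_le_of_ne a.2 fun h => ha (Subtype.ext h.symm)) ?_
        rw [add_zero]; exact hx
  · refine Submodule.span_le.2 ?_
    rintro _ ⟨u, hu, rfl⟩
    exact hu.2

/-- A face is determined by which of the finitely many generators lie on it. -/
theorem finite_setOf_isFace (hfg : S.FG) : {D | IsFace S D}.Finite := by
  obtain ⟨A, hA⟩ := hfg
  refine Set.Finite.of_finite_image (f := fun D => {u ∈ (A : Set (Fin n → ℤ)) | toReal n u ∈ D})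
    ((A.finite_toSet.finite_subsets).subset ?_) ?_
  · rintro _ ⟨D, -, rfl⟩
    exact Set.sep_subset _ _
  · intro D hD D' hD' h
    rw [IsFace.eq_hull hD hA, IsFace.eq_hull hD' hA]
    exact congrArg (fun B => PointedCone.hull ℝ (toReal n '' B)) h

/-- Every element of the span of a face `D` can be moved into the relative interior of `D` by
adding an element of `S ∩ D`. -/
theorem IsFace.exists_add_mem {D : PointedCone ℝ (Fin n → ℝ)} (hD : IsFace S D) (hfg : S.FG)
    {w : Fin n → ℝ} (hw : w ∈ Submodule.span ℝ (D : Set (Fin n → ℝ))) :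
    ∃ t ∈ S, toReal n t ∈ D ∧ w + toReal n t ∈ D ∧ D ≤ minFace S (w + toReal n t) := by
  classical
  obtain ⟨A, hA⟩ := hfg
  set B : Finset (Fin n → ℤ) := {u ∈ A | toReal n u ∈ D} with hB
  have hBS : ∀ u ∈ B, u ∈ S := fun u hu => hA ▸ AddSubmonoid.subset_closure (by
    simpa using (Finset.mem_filter.1 hu).1)
  have hBD : ∀ u ∈ B, toReal n u ∈ D := fun u hu => (Finset.mem_filter.1 hu).2
  have hDB : D = PointedCone.hull ℝ (toReal n '' (B : Set (Fin n → ℤ))) := by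
    conv_lhs => rw [IsFace.eq_hull hD hA]
    simp [hB]
  set t₀ : Fin n → ℤ := ∑ u ∈ B, u with ht₀
  have ht₀S : t₀ ∈ S := sum_mem hBS
  have ht₀D : toReal n t₀ ∈ D := by rw [ht₀, map_sum]; exact sum_mem hBD
  have hDle : D ≤ minFace S (toReal n t₀) := by
    rw [hDB]
    refine Submodule.span_le.2 ?_
    rintro _ ⟨u, hu, rfl⟩
    refine ⟨hD.le (hBD u hu), 1, zero_le_one, ?_⟩
    rw [one_smul, ← map_sub, ht₀, ← Finset.sum_erase_add _ _ hu, add_sub_cancel_right]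
    exact toReal_mem_cone (sum_mem fun x hx => hBS x (Finset.mem_of_mem_erase hx))
  -- Write `w = y - z` with `y, z ∈ D`; a large multiple of `t₀`, the sum of the generators on `D`,
  -- absorbs `z`.
  have key : ∃ N : ℕ, w + (N : ℝ) • toReal n t₀ ∈ D := by
    have hsub : ∃ y ∈ D, ∃ z ∈ D, w = y - z := by
      clear_value t₀ B
      induction hw using Submodule.span_induction with
      | mem x h => exact ⟨x, h, 0, zero_mem _, by simp⟩
      | zero => exact ⟨0, zero_mem _, 0, zero_mem _, by simp⟩
      | add x x' _ _ hx hx' =>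
        obtain ⟨y, hy, z, hz, rfl⟩ := hx
        obtain ⟨y', hy', z', hz', rfl⟩ := hx'
        exact ⟨y + y', add_mem hy hy', z + z', add_mem hz hz', by abel⟩
      | smul a x _ hx =>
        obtain ⟨y, hy, z, hz, rfl⟩ := hx
        rcases le_total 0 a with ha | ha
        · exact ⟨a • y, D.smul_mem ha hy, a • z, D.smul_mem ha hz, smul_sub _ _ _⟩
        · refine ⟨(-a) • z, D.smul_mem (neg_nonneg.2 ha) hz, (-a) • y,
            D.smul_mem (neg_nonneg.2 ha) hy, ?_⟩
          rw [smul_sub, neg_smul, neg_smul]; abel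
    obtain ⟨y, hy, z, hz, rfl⟩ := hsub
    obtain ⟨hzC, r, hr, h⟩ := hDle hz
    obtain ⟨N, hN⟩ := exists_nat_ge r
    have h1 : r • toReal n t₀ - z ∈ D :=
      PointedCone.IsFaceOf.mem_of_add_mem_left hD h hzC
        (by rw [sub_add_cancel]; exact D.smul_mem hr ht₀D)
    refine ⟨N, ?_⟩
    convert add_mem hy (add_mem h1 (D.smul_mem (sub_nonneg.2 hN) ht₀D)) using 1
    rw [sub_smul]; abel
  obtain ⟨N, hN⟩ := key
  -- The extra copy of `t₀` moves the point from `D` into its relative interior.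
  have hcast : toReal n ((N + 1) • t₀) = (N : ℝ) • toReal n t₀ + toReal n t₀ := by
    rw [toReal_nsmul_eq]; push_cast; rw [add_smul, one_smul]
  have hmem : w + toReal n ((N + 1) • t₀) ∈ D := by
    rw [hcast, ← add_assoc]; exact add_mem hN ht₀D
  refine ⟨(N + 1) • t₀, nsmul_mem ht₀S _, ?_, hmem, ?_⟩
  · rw [toReal_nsmul_eq]; exact D.smul_mem (by positivity) ht₀D
  · refine hDle.trans (minFace_le (isFace_minFace _) ?_)
    refine PointedCone.IsFaceOf.mem_of_add_mem_right (isFace_minFace _) (hD.le hN)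
      (hD.le ht₀D) ?_
    rw [add_assoc, ← hcast]
    exact mem_minFace_self (hD.le hmem)

/-! ### Integral inequalities for rational cones -/

theorem toReal_zsmul_eq (m : ℤ) (u : Fin n → ℤ) : toReal n (m • u) = (m : ℝ) • toReal n u := by
  ext i; simp [toReal_apply]

theorem toReal_dotProduct (a u : Fin n → ℤ) :
    toReal n a ⬝ᵥ toReal n u = ((a ⬝ᵥ u : ℤ) : ℝ) := by
  simp [dotProduct, toReal_apply]

/-- A cone generated by finitely many lattice points is cut out by finitely many integral linear
inequalities. -/
theorem exists_integral_inequalities (B : Finset (Fin n → ℤ)) :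
    ∃ F : Finset (Fin n → ℤ), ∀ x : Fin n → ℝ,
      x ∈ PointedCone.hull ℝ (toReal n '' (B : Set (Fin n → ℤ))) ↔
        ∀ a ∈ F, 0 ≤ toReal n a ⬝ᵥ x := by
  classical
  induction B using Finset.induction_on with
  | empty =>
    refine ⟨Finset.univ.image (fun i => Pi.single i 1) ∪
      Finset.univ.image (fun i => Pi.single i (-1)), fun x => ?_⟩
    have hval : ∀ (i : Fin n) (c : ℤ), toReal n (Pi.single i c) ⬝ᵥ x = c * x i := by
      intro i c
      have : toReal n (Pi.single i c) = Pi.single i (c : ℝ) := by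
        ext j
        rcases eq_or_ne j i with rfl | h
        · simp [toReal_apply]
        · simp [toReal_apply, h]
      rw [this, single_dotProduct]
    simp only [Finset.coe_empty, Set.image_empty, Submodule.span_empty, Submodule.mem_bot]
    constructor
    · rintro rfl a -
      simp
    · intro h
      ext i
      have h1 := h (Pi.single i 1) (by simp)
      have h2 := h (Pi.single i (-1)) (by simp)
      rw [hval] at h1 h2
      push_cast at h1 h2
      simp only [Pi.zero_apply]
      linarith
  | insert h B _ ih =>
    obtain ⟨F, hF⟩ := ih
    -- Fourier–Motzkin elimination of `t ≥ 0` from `x - t • h ∈ hull B`: the first family pairs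
    -- upper bounds on `t` with the bound `0`, the second pairs them with the other lower bounds.
    refine ⟨F.filter (fun a => 0 ≤ a ⬝ᵥ h) ∪
      Finset.image₂ (fun a b => (b ⬝ᵥ h) • a - (a ⬝ᵥ h) • b) (F.filter (fun a => a ⬝ᵥ h < 0))
        (F.filter (fun b => 0 < b ⬝ᵥ h)), fun x => ?_⟩
    have hval : ∀ a b : Fin n → ℤ, toReal n ((b ⬝ᵥ h) • a - (a ⬝ᵥ h) • b) ⬝ᵥ x =
        ((b ⬝ᵥ h : ℤ) : ℝ) * (toReal n a ⬝ᵥ x) - ((a ⬝ᵥ h : ℤ) : ℝ) * (toReal n b ⬝ᵥ x) := by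
      intro a b
      rw [map_sub, toReal_zsmul_eq, toReal_zsmul_eq, sub_dotProduct, smul_dotProduct,
        smul_dotProduct, smul_eq_mul, smul_eq_mul]
    have hins : x ∈ PointedCone.hull ℝ (toReal n '' ((insert h B : Finset (Fin n → ℤ)) :
        Set (Fin n → ℤ))) ↔
        ∃ t : ℝ, 0 ≤ t ∧ ∀ a ∈ F, t * ((a ⬝ᵥ h : ℤ) : ℝ) ≤ toReal n a ⬝ᵥ x := by
      rw [Finset.coe_insert, Set.image_insert_eq, PointedCone.hull, Submodule.mem_span_insert]
      constructor
      · rintro ⟨t, z, hz, rfl⟩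
        refine ⟨t, t.2, fun a ha => ?_⟩
        have := (hF z).1 hz a ha
        rw [dotProduct_add, show t • toReal n h = (t : ℝ) • toReal n h from rfl, dotProduct_smul,
          toReal_dotProduct, smul_eq_mul]
        linarith
      · rintro ⟨t, ht, h'⟩
        refine ⟨⟨t, ht⟩, x - t • toReal n h, (hF _).2 fun a ha => ?_, ?_⟩
        · rw [dotProduct_sub, dotProduct_smul, toReal_dotProduct, smul_eq_mul]
          linarith [h' a ha]
        · exact (add_sub_cancel _ _).symm
    rw [hins]
    simp only [Finset.mem_union, Finset.mem_filter, Finset.mem_image₂]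
    constructor
    · rintro ⟨t, ht, h'⟩ c (⟨hc, hc0⟩ | ⟨a, ⟨ha, ha0⟩, b, ⟨hb, hb0⟩, rfl⟩)
      · exact (mul_nonneg ht (by exact_mod_cast hc0)).trans (h' c hc)
      · rw [hval]
        have ha0' : ((a ⬝ᵥ h : ℤ) : ℝ) < 0 := by exact_mod_cast ha0
        have hb0' : (0 : ℝ) < ((b ⬝ᵥ h : ℤ) : ℝ) := by exact_mod_cast hb0
        have h1 := mul_le_mul_of_nonneg_left (h' a ha) hb0'.le
        have h2 := mul_le_mul_of_nonneg_left (h' b hb) (neg_nonneg.2 ha0'.le)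
        linarith
    · intro h'
      -- The largest lower bound is taken for `t`.
      obtain ⟨t, ht, hmax⟩ := Finset.exists_max_image
        (insert (0 : ℝ) ((F.filter (fun a => a ⬝ᵥ h < 0)).image
          (fun a => toReal n a ⬝ᵥ x / ((a ⬝ᵥ h : ℤ) : ℝ)))) id ⟨0, Finset.mem_insert_self _ _⟩
      refine ⟨t, hmax 0 (Finset.mem_insert_self _ _), fun c hc => ?_⟩
      rcases lt_trichotomy (c ⬝ᵥ h) 0 with hc0 | hc0 | hc0
      · have := hmax _ (Finset.mem_insert_of_mem (Finset.mem_image_of_mem _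
          (Finset.mem_filter.2 ⟨hc, hc0⟩)))
        exact (div_le_iff_of_neg (by exact_mod_cast hc0)).1 this
      · rw [hc0]
        simpa using h' c (Or.inl ⟨hc, hc0.ge⟩)
      · have hc0' : (0 : ℝ) < ((c ⬝ᵥ h : ℤ) : ℝ) := by exact_mod_cast hc0
        rcases Finset.mem_insert.1 ht with rfl | ht
        · rw [zero_mul]; exact h' c (Or.inl ⟨hc, hc0.le⟩)
        · obtain ⟨a, ha, rfl⟩ := Finset.mem_image.1 ht
          obtain ⟨ha, ha0⟩ := Finset.mem_filter.1 ha
          have ha0' : ((a ⬝ᵥ h : ℤ) : ℝ) < 0 := by exact_mod_cast ha0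
          have := h' _ (Or.inr ⟨a, ⟨ha, ha0⟩, c, ⟨hc, hc0⟩, rfl⟩)
          rw [hval] at this
          rw [div_mul_eq_mul_div, div_le_iff_of_neg ha0']
          linarith

/-- For `q` large, a lattice point `z` with `u + q z ∈ C(S)` lies in `C(S)`. -/
theorem exists_forall_mem_cone_of_add_nsmul_mem (hfg : S.FG) (u : Fin n → ℤ) :
    ∃ N : ℕ, ∀ q : ℕ, N ≤ q → ∀ z : Fin n → ℤ, toReal n (u + q • z) ∈ cone S →
      toReal n z ∈ cone S := by
  obtain ⟨A, hA⟩ := hfg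
  obtain ⟨F, hF⟩ := exists_integral_inequalities A
  rw [← cone_eq_hull_of_closure hA] at hF
  -- This makes `q` exceed every `|a ⬝ᵥ u|`. By integrality a negative `a ⬝ᵥ z` is at most `-1`,
  -- which would make `a ⬝ᵥ (u + q • z)` negative.
  refine ⟨∑ a ∈ F, (a ⬝ᵥ u).natAbs + 1, fun q hq z hz => (hF _).2 fun a ha => ?_⟩
  have h1 := (hF _).1 hz a ha
  rw [toReal_dotProduct] at h1 ⊢
  have h2 : 0 ≤ a ⬝ᵥ u + q * (a ⬝ᵥ z) := by
    rw [dotProduct_add, dotProduct_smul, nsmul_eq_mul] at h1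
    exact_mod_cast h1
  have h3 : (a ⬝ᵥ u).natAbs < q :=
    (Finset.single_le_sum (f := fun a => (a ⬝ᵥ u).natAbs) (fun _ _ => Nat.zero_le _) ha).trans_lt hq
  have h4 : a ⬝ᵥ u < q := by omega
  have h5 : 0 ≤ a ⬝ᵥ z := by
    by_contra hneg
    have : a ⬝ᵥ z ≤ -1 := by omega
    nlinarith
  exact_mod_cast h5

/-! ### Indices of face lattices -/

/-- A lattice point in the real span of a set of lattice points has a positive multiple in the group
generated by the set. -/
theorem exists_nsmul_mem_closure {A : Set (Fin n → ℤ)} {z : Fin n → ℤ}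
    (hz : toReal n z ∈ Submodule.span ℝ (toReal n '' A)) :
    ∃ m : ℕ, 0 < m ∧ m • z ∈ AddSubgroup.closure A := by
  let toRat : (Fin n → ℤ) →+ (Fin n → ℚ) := (Int.castAddHom ℚ).compLeft (Fin n)
  have hinj : Function.Injective toRat := fun u v h => by
    ext i; exact Int.cast_injective (congrFun h i : ((u i : ℤ) : ℚ) = (v i : ℤ))
  -- Descent from `ℝ` to `ℚ` by duality: a rational functional vanishing on `A` but not at `z` would
  -- extend to a real one doing the same.
  have hzQ : toRat z ∈ Submodule.span ℚ (toRat '' A) := by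
    by_contra hnot
    obtain ⟨f, hf0, hf⟩ := Submodule.exists_le_ker_of_notMem hnot
    let g : (Fin n → ℝ) →ₗ[ℝ] ℝ :=
      ∑ i, ((f (Pi.single i 1) : ℚ) : ℝ) • LinearMap.proj (R := ℝ) (φ := fun _ : Fin n => ℝ) i
    have hg : ∀ u : Fin n → ℤ, g (toReal n u) = ((f (toRat u) : ℚ) : ℝ) := by
      intro u
      have : f (toRat u) = ∑ i, (u i : ℚ) * f (Pi.single i 1) := by
        conv_lhs => rw [LinearMap.pi_apply_eq_sum_univ f (toRat u)]
        refine Finset.sum_congr rfl fun i _ => ?_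
        rw [smul_eq_mul]
        congr 2
        ext j
        simp [Pi.single_apply, eq_comm]
      rw [this]
      simp [g, toReal_apply, mul_comm]
    have hle : Submodule.span ℝ (toReal n '' A) ≤ LinearMap.ker g := by
      refine Submodule.span_le.2 ?_
      rintro _ ⟨u, hu, rfl⟩
      have : f (toRat u) = 0 := hf (Submodule.subset_span ⟨u, hu, rfl⟩)
      change g _ = 0
      rw [hg, this, Rat.cast_zero]
    have := hle hz
    rw [LinearMap.mem_ker, hg] at this
    exact hf0 (by exact_mod_cast this)
  have key : ∀ x ∈ Submodule.span ℚ (toRat '' A), ∃ m : ℕ, 0 < m ∧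
      ∃ w ∈ AddSubgroup.closure A, (m : ℚ) • x = toRat w := by
    intro x hx
    induction hx using Submodule.span_induction with
    | mem x h =>
      obtain ⟨u, hu, rfl⟩ := h
      exact ⟨1, one_pos, u, AddSubgroup.subset_closure hu, by simp⟩
    | zero => exact ⟨1, one_pos, 0, zero_mem _, by simp⟩
    | add x y _ _ hx hy =>
      obtain ⟨m, hm, w, hw, h⟩ := hx
      obtain ⟨m', hm', w', hw', h'⟩ := hy
      refine ⟨m * m', Nat.mul_pos hm hm', m' • w + m • w',
        add_mem (nsmul_mem hw _) (nsmul_mem hw' _), ?_⟩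
      rw [map_add, map_nsmul, map_nsmul, ← h, ← h', ← Nat.cast_smul_eq_nsmul ℚ,
        ← Nat.cast_smul_eq_nsmul ℚ, smul_add, smul_smul, smul_smul, Nat.cast_mul,
        mul_comm (m' : ℚ)]
    | smul a x _ hx =>
      obtain ⟨m, hm, w, hw, h⟩ := hx
      refine ⟨m * a.den, Nat.mul_pos hm a.den_pos, a.num • w, zsmul_mem hw _, ?_⟩
      rw [map_zsmul, ← h, ← Int.cast_smul_eq_zsmul ℚ, smul_smul, smul_smul, Nat.cast_mul,
        mul_assoc, Rat.den_mul_eq_num, mul_comm]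
  obtain ⟨m, hm, w, hw, h⟩ := key _ hzQ
  refine ⟨m, hm, ?_⟩
  have : m • z = w := hinj (by rw [map_nsmul, ← h, Nat.cast_smul_eq_nsmul])
  rwa [this]

/-- A subgroup of a finitely generated abelian group has nonzero relative index if the larger group
is torsion modulo the smaller one. -/
theorem relIndex_ne_zero_of_torsion {G : Type*} [AddCommGroup G] {H K : AddSubgroup G}
    (hK : K.FG) (h : ∀ z ∈ K, ∃ m : ℕ, 0 < m ∧ m • z ∈ H) : H.relIndex K ≠ 0 := by
  have hKfg : AddGroup.FG K := (AddGroup.fg_iff_addSubgroup_fg K).2 hK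
  have : Finite (K ⧸ H.addSubgroupOf K) := by
    refine AddCommGroup.finite_of_fg_isAddTorsion _ ?_
    intro x
    obtain ⟨z, rfl⟩ := QuotientAddGroup.mk_surjective x
    obtain ⟨m, hm, hmz⟩ := h z z.2
    refine isOfFinAddOrder_iff_nsmul_eq_zero.2 ⟨m, hm, ?_⟩
    rw [← QuotientAddGroup.mk_nsmul, QuotientAddGroup.eq_zero_iff, AddSubgroup.mem_addSubgroupOf]
    exact hmz
  exact AddSubgroup.index_ne_zero_of_finite

theorem IsFace.exists_nsmul_mem_faceLattice {D : PointedCone ℝ (Fin n → ℝ)} (hD : IsFace S D)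
    {z : Fin n → ℤ} (hz : z ∈ spanPoints D) :
    ∃ m : ℕ, 0 < m ∧ m • z ∈ faceLattice S D := by
  refine exists_nsmul_mem_closure (A := {u | u ∈ S ∧ toReal n u ∈ D})
    ((Submodule.span_le.2 ?_ : Submodule.span ℝ (D : Set (Fin n → ℝ)) ≤ _) hz)
  exact (IsFace.eq_hull hD (AddSubmonoid.closure_eq S)).le.trans (PointedCone.hull_le_span ℝ _)

/-- An infinite index is recorded as `0`, which `p` divides; finiteness ensures that `IsPFace`
really detects `p`-torsion. -/
theorem IsFace.relIndex_ne_zero {D : PointedCone ℝ (Fin n → ℝ)} (hD : IsFace S D) :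
    (faceLattice S D).relIndex (lattice S ⊓ spanPoints D) ≠ 0 := by
  refine relIndex_ne_zero_of_torsion ?_ fun z hz => hD.exists_nsmul_mem_faceLattice hz.2
  exact (AddGroup.fg_iff_addSubgroup_fg _).1
    (Module.Finite.iff_addGroup_fg.1 (Module.Finite.of_fg (IsNoetherian.noetherian
      (AddSubgroup.toIntSubmodule (lattice S ⊓ spanPoints D)))))

/-- `D` is a `p`-face if and only if `(M ∩ ⟨D⟩) / M_D` has `p`-torsion. -/
theorem isPFace_iff {p : ℕ} [hp : Fact p.Prime] {D : PointedCone ℝ (Fin n → ℝ)}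
    (hD : IsFace S D) :
    IsPFace S p D ↔ ∃ z ∈ lattice S, z ∈ spanPoints D ∧ p • z ∈ faceLattice S D ∧
      z ∉ faceLattice S D := by
  have h0 := hD.relIndex_ne_zero
  set K := lattice S ⊓ spanPoints D with hK
  set H := (faceLattice S D).addSubgroupOf K with hH
  have : H.FiniteIndex := ⟨h0⟩
  have : Finite (K ⧸ H) := inferInstance
  constructor
  · rintro ⟨-, hdvd⟩
    obtain ⟨x, hx⟩ := exists_prime_addOrderOf_dvd_card' (G := K ⧸ H) p hdvd
    obtain ⟨z, rfl⟩ := QuotientAddGroup.mk_surjective x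
    refine ⟨z, z.2.1, z.2.2, ?_, fun hz => ?_⟩
    · have := addOrderOf_nsmul_eq_zero (z : K ⧸ H)
      rw [hx, ← QuotientAddGroup.mk_nsmul, QuotientAddGroup.eq_zero_iff,
        AddSubgroup.mem_addSubgroupOf] at this
      exact this
    · have : (z : K ⧸ H) = 0 := (QuotientAddGroup.eq_zero_iff z).2 (AddSubgroup.mem_addSubgroupOf.2 hz)
      rw [this, addOrderOf_zero] at hx
      exact hp.out.one_lt.ne hx
  · rintro ⟨z, hzM, hzD, hpz, hz⟩
    refine ⟨hD, ?_⟩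
    let x : K ⧸ H := ((⟨z, hzM, hzD⟩ : K) : K ⧸ H)
    have hx0 : x ≠ 0 := fun h => hz (AddSubgroup.mem_addSubgroupOf.1
      ((QuotientAddGroup.eq_zero_iff _).1 h))
    have hpx : p • x = 0 := by
      rw [← QuotientAddGroup.mk_nsmul, QuotientAddGroup.eq_zero_iff, AddSubgroup.mem_addSubgroupOf]
      exact hpz
    rw [← addOrderOf_eq_prime hpx hx0]
    exact addOrderOf_dvd_natCard x

/-- Off the `p`-faces `(M ∩ ⟨D⟩) / M_D` has no `p`-torsion, so powers of `p` can be cancelled. -/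
theorem mem_faceLattice_of_pow_nsmul_mem {p : ℕ} [hp : Fact p.Prime]
    {D : PointedCone ℝ (Fin n → ℝ)} (hD : IsFace S D) (hpD : ¬ IsPFace S p D) {z : Fin n → ℤ}
    (hz : z ∈ lattice S) (hzD : z ∈ spanPoints D) (e : ℕ)
    (h : p ^ e • z ∈ faceLattice S D) : z ∈ faceLattice S D := by
  induction e with
  | zero => simpa using h
  | succ e ih =>
    refine ih (by_contra fun hne => hpD ((isPFace_iff hD).2 ⟨p ^ e • z, nsmul_mem hz _,
      nsmul_mem hzD _, ?_, hne⟩))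
    rwa [smul_smul, ← pow_succ']

/-! ### The Cartier relation on exponents -/

/-- The combinatorial condition for the existence of a `p⁻ᵉ`-linear map on `k[S]` that is
homogeneous and sends `x^u` to `x^v`. -/
def CartierRel (S : AddSubmonoid (Fin n → ℤ)) (p e : ℕ) (u v : Fin n → ℤ) : Prop :=
  ∀ z ∈ lattice S, u + p ^ e • z ∈ S → v + z ∈ S

theorem le_lattice : ∀ u ∈ S, u ∈ lattice S := fun _ hu => AddSubgroup.subset_closure hu

theorem mem_minFace_add {x y : Fin n → ℝ} (hx : x ∈ cone S) (hy : y ∈ cone S) :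
    x ∈ minFace S (x + y) ∧ y ∈ minFace S (x + y) :=
  (PointedCone.IsFaceOf.add_mem_iff_mem (isFace_minFace _) hx hy).1
    (mem_minFace_self (add_mem hx hy))

theorem toReal_add_pow_nsmul (p e : ℕ) (u z : Fin n → ℤ) :
    toReal n (u + p ^ e • z) = toReal n u + ((p : ℝ) ^ e) • toReal n z := by
  rw [map_add, toReal_nsmul_eq, Nat.cast_pow]

theorem mem_minFace_add_pow_nsmul {p : ℕ} [hp : Fact p.Prime] (e : ℕ) {u z : Fin n → ℤ}
    (hu : toReal n u ∈ cone S) (hz : toReal n z ∈ cone S) :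
    toReal n (u + p ^ e • z) ∈ cone S ∧
      toReal n u ∈ minFace S (toReal n (u + p ^ e • z)) ∧
      toReal n z ∈ minFace S (toReal n (u + p ^ e • z)) := by
  have hpos : (0 : ℝ) < (p : ℝ) ^ e := pow_pos (by exact_mod_cast hp.out.pos) e
  rw [toReal_add_pow_nsmul]
  have hz' : ((p : ℝ) ^ e) • toReal n z ∈ cone S := PointedCone.smul_mem _ hpos.le hz
  have h := mem_minFace_add hu hz'
  refine ⟨add_mem hu hz', h.1, ?_⟩
  refine (isFace_minFace _).mem_of_smul_add_mem hz (zero_mem _) hpos ?_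
  rw [add_zero]; exact h.2

theorem isRelativelySaturated_iff {D : PointedCone ℝ (Fin n → ℝ)} :
    IsRelativelySaturated S D ↔ ∀ z, (∀ D', IsFace S D' → D < D' →
      z ∈ faceLattice S D' ∧ z ∈ spanPoints D) → z ∈ faceLattice S D := by
  unfold IsRelativelySaturated
  have hle : faceLattice S D ≤ ⨅ (D' : PointedCone ℝ (Fin n → ℝ)) (_ : IsFace S D') (_ : D < D'),
      faceLattice S D' ⊓ spanPoints D :=
    le_iInf fun D' => le_iInf fun _ => le_iInf fun h =>
      le_inf (faceLattice_mono h.le) (faceLattice_le_spanPoints D)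
  constructor
  · intro h z hz
    rw [h]
    simpa only [AddSubgroup.mem_iInf, AddSubgroup.mem_inf] using hz
  · refine fun h => le_antisymm hle fun z hz => h z ?_
    simpa only [AddSubgroup.mem_iInf, AddSubgroup.mem_inf] using hz

/-- Take `z ∉ M_D` lying in `M_{D'}` for every face `D'` strictly above `D`, shifted by `t ∈ S ∩ D`
into `int(D)`. If `u ∉ D`, the minimal face of `u + pᵉ(z + t)` is strictly larger than `D`, so by
seminormality this point is in `S`. The relation then puts `v + z + t` in `S ∩ D`, whence `z ∈ M_D`.
-/
theorem CartierRel.mem_of_isProperRUF (hfg : S.FG) (hsn : IsSeminormal S) {p e : ℕ}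
    [Fact p.Prime] {u v : Fin n → ℤ} (h : CartierRel S p e u v) (hu : u ∈ S) (hv : v ∈ S)
    {D : PointedCone ℝ (Fin n → ℝ)} (hD : IsProperRUF S D) (hvD : toReal n v ∈ D) :
    toReal n u ∈ D := by
  obtain ⟨⟨hDf, hor⟩, hDC⟩ := hD
  have hlt : D < cone S := lt_of_le_of_ne hDf.le hDC
  have hsat := hor.resolve_left hDC
  rw [isRelativelySaturated_iff] at hsat
  push Not at hsat
  obtain ⟨z, hz, hzD⟩ := hsat
  by_contra huD
  have hzspan := (hz _ isFace_cone hlt).2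
  have hzM : z ∈ lattice S := faceLattice_le_lattice _ (hz _ isFace_cone hlt).1
  obtain ⟨t, htS, htD, hztD, hle⟩ := IsFace.exists_add_mem hDf hfg hzspan
  rw [← map_add] at hztD hle
  obtain ⟨hxC, huG, hztG⟩ := mem_minFace_add_pow_nsmul (p := p) e (toReal_mem_cone hu)
    (hDf.le hztD)
  set G := minFace S (toReal n (u + p ^ e • (z + t))) with hG
  have hDG : D ≤ G := hle.trans (minFace_le (isFace_minFace _) hztG)
  have hDG' : D < G := lt_of_le_of_ne hDG fun h => huD (h ▸ huG)
  have hzG := (hz G (isFace_minFace _) hDG').1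
  have hxS : u + p ^ e • (z + t) ∈ S :=
    hsn.mem_of_mem_faceLattice hxC le_rfl (add_mem (mem_faceLattice_of_mem hu huG)
      (nsmul_mem (add_mem hzG (mem_faceLattice_of_mem htS (hDG htD))) _))
  have hvS := h _ (add_mem hzM (le_lattice t htS)) hxS
  have hvz : v + (z + t) ∈ faceLattice S D :=
    mem_faceLattice_of_mem hvS (by rw [map_add]; exact add_mem hvD hztD)
  refine hzD ?_
  have := sub_mem (sub_mem hvz (mem_faceLattice_of_mem hv hvD)) (mem_faceLattice_of_mem htS htD)
  rwa [show v + (z + t) - v - t = z by abel] at this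

/-- If `v ∈ D` then also `u ∈ D`. Now `z` is a `p`-torsion class modulo `M_D`: since `e > 0`, `pᵉ z`
lies in `M_D`, and the shift argument again yields `z ∈ M_D`. -/
theorem CartierRel.notMem_of_isPRUF (hfg : S.FG) (hsn : IsSeminormal S) {p e : ℕ}
    [Fact p.Prime] (he : 0 < e) {u v : Fin n → ℤ} (h : CartierRel S p e u v) (hu : u ∈ S)
    (hv : v ∈ S) {D : PointedCone ℝ (Fin n → ℝ)} (hD : IsPRUF S p D) : toReal n v ∉ D := by
  intro hvD
  have hDf : IsFace S D := hD.1.1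
  have huD : toReal n u ∈ D := by
    by_cases hDC : D = cone S
    · rw [hDC]; exact toReal_mem_cone hu
    · exact h.mem_of_isProperRUF hfg hsn hu hv ⟨hD.1, hDC⟩ hvD
  obtain ⟨z, hzM, hzspan, hpz, hzD⟩ := (isPFace_iff hDf).1 hD.2
  obtain ⟨t, htS, htD, hztD, hle⟩ := IsFace.exists_add_mem hDf hfg hzspan
  rw [← map_add] at hztD hle
  obtain ⟨hxC, -, hztG⟩ := mem_minFace_add_pow_nsmul (p := p) e (toReal_mem_cone hu)
    (hDf.le hztD)
  have hpez : p ^ e • z ∈ faceLattice S D := by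
    obtain ⟨e, rfl⟩ := Nat.exists_eq_add_of_lt he
    rw [zero_add, pow_succ, mul_smul]
    exact nsmul_mem hpz _
  have hxS : u + p ^ e • (z + t) ∈ S := by
    refine hsn.mem_of_mem_faceLattice hxC (hle.trans (minFace_le (isFace_minFace _) hztG)) ?_
    rw [smul_add]
    exact add_mem (mem_faceLattice_of_mem hu huD)
      (add_mem hpez (nsmul_mem (mem_faceLattice_of_mem htS htD) _))
  have hvS := h _ (add_mem hzM (le_lattice t htS)) hxS
  have hvz : v + (z + t) ∈ faceLattice S D :=
    mem_faceLattice_of_mem hvS (by rw [map_add]; exact add_mem hvD hztD)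
  refine hzD ?_
  have := sub_mem (sub_mem hvz (mem_faceLattice_of_mem hv hvD)) (mem_faceLattice_of_mem htS htD)
  rwa [show v + (z + t) - v - t = z by abel] at this

theorem spanPoints_mono {D D' : PointedCone ℝ (Fin n → ℝ)} (h : D ≤ D') :
    spanPoints D ≤ spanPoints D' := fun _ hz => Submodule.span_mono h hz

/-- Every `p`-face is contained in a relatively unsaturated `p`-face. -/
theorem IsPFace.exists_le_isPRUF (hfg : S.FG) {p : ℕ} [Fact p.Prime]
    {D : PointedCone ℝ (Fin n → ℝ)} (hD : IsPFace S p D) : ∃ G, IsPRUF S p G ∧ D ≤ G := by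
  -- A maximal `p`-face `G` is unsaturated: no face strictly above `G` is a `p`-face, so a
  -- `p`-torsion class modulo `M_G` lies in the lattices of all of them.
  obtain ⟨G, hDG, hG⟩ := ((finite_setOf_isFace hfg).subset fun (D : PointedCone ℝ (Fin n → ℝ))
    (h : IsPFace S p D) => h.1).exists_le_maximal hD
  refine ⟨G, ⟨⟨hG.prop.1, ?_⟩, hG.prop⟩, hDG⟩
  refine Or.inr fun hsat => ?_
  obtain ⟨z, hzM, hzspan, hpz, hzG⟩ := (isPFace_iff hG.prop.1).1 hG.prop
  refine hzG (isRelativelySaturated_iff.1 hsat z fun G' hG' hlt => ⟨?_, hzspan⟩)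
  refine mem_faceLattice_of_pow_nsmul_mem (p := p) hG' (fun h => hG.not_prop_of_gt hlt h) hzM
    (spanPoints_mono hlt.le hzspan) 1 ?_
  rw [pow_one]
  exact faceLattice_mono hlt.le hpz

theorem not_isPFace_cone {p : ℕ} [Fact p.Prime] : ¬ IsPFace S p (cone S) := fun h => by
  obtain ⟨z, hz, -, -, hz'⟩ := (isPFace_iff isFace_cone).1 h
  exact hz' (faceLattice_cone (S := S) ▸ hz)

theorem IsPRUF.isProperRUF {p : ℕ} [Fact p.Prime] {D : PointedCone ℝ (Fin n → ℝ)}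
    (hD : IsPRUF S p D) : IsProperRUF S D :=
  ⟨hD.1, fun h => not_isPFace_cone (h ▸ hD.2)⟩

theorem IsPRUF.exists_le_isMaximalPRUF (hfg : S.FG) {p : ℕ} {D : PointedCone ℝ (Fin n → ℝ)}
    (hD : IsPRUF S p D) : ∃ G, IsMaximalPRUF S p G ∧ D ≤ G := by
  obtain ⟨G, hDG, hG⟩ := ((finite_setOf_isFace hfg).subset fun (D : PointedCone ℝ (Fin n → ℝ))
    (h : IsPRUF S p D) => h.1.1).exists_le_maximal hD
  exact ⟨G, hG, hDG⟩

/-- From `p(v + z) = (v + pz) + (p - 1)v`, the minimal face `G` of `v + z` contains `v` and `v +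
pz`. Hence `pz ∈ M_G`, and `G`, containing `v`, is not a `p`-face. -/
theorem cartierRel_self (hsn : IsSeminormal S) {p : ℕ} [hp : Fact p.Prime] {v : Fin n → ℤ}
    (hv : v ∈ S) (hvp : ∀ D, IsPFace S p D → toReal n v ∉ D) : CartierRel S p 1 v v := by
  intro z hzM hx
  rw [pow_one] at hx
  have hp0 : (0 : ℝ) < p := by exact_mod_cast hp.out.pos
  have hp1 : (1 : ℝ) < p := by exact_mod_cast hp.out.one_lt
  have hsum : (p : ℝ) • toReal n (v + z) = toReal n (v + p • z) + ((p : ℝ) - 1) • toReal n v := by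
    rw [map_add, map_add, toReal_nsmul_eq, smul_add, sub_smul, one_smul]; abel
  have hv1 : ((p : ℝ) - 1) • toReal n v ∈ cone S :=
    PointedCone.smul_mem _ (by linarith) (toReal_mem_cone hv)
  have hC : toReal n (v + z) ∈ cone S := by
    have := PointedCone.smul_mem (cone S) (inv_nonneg.2 hp0.le)
      (hsum ▸ add_mem (toReal_mem_cone hx) hv1)
    rwa [smul_smul, inv_mul_cancel₀ hp0.ne', one_smul] at this
  have hG := isFace_minFace (S := S) (toReal n (v + z))
  set G := minFace S (toReal n (v + z)) with hGdef
  have hmem := (PointedCone.IsFaceOf.add_mem_iff_mem hG (toReal_mem_cone hx) hv1).1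
    (hsum ▸ PointedCone.smul_mem G hp0.le (mem_minFace_self hC))
  have hvG : toReal n v ∈ G := hG.mem_of_smul_add_mem (toReal_mem_cone hv) (zero_mem _)
    (show (0 : ℝ) < p - 1 by linarith) (by rw [add_zero]; exact hmem.2)
  have hvM := mem_faceLattice_of_mem hv hvG
  have hpz : p ^ 1 • z ∈ faceLattice S G := by
    have := sub_mem (mem_faceLattice_of_mem hx hmem.1) hvM
    rwa [add_sub_cancel_left, ← pow_one p] at this
  have hzspan : z ∈ spanPoints G := by
    have := sub_mem (mem_spanPoints_of_mem (mem_minFace_self hC)) (mem_spanPoints_of_mem hvG)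
    rwa [add_sub_cancel_left] at this
  exact hsn.mem_of_mem_faceLattice hC le_rfl (add_mem hvM
    (mem_faceLattice_of_pow_nsmul_mem hG (fun h => hvp G h hvG) hzM hzspan 1 hpz))

/-- Choosing `e` large forces `z` into the cone. It then suffices that `z` lies in the lattice of
the minimal face of `v + z`. -/
theorem exists_cartierRel (hfg : S.FG) (hsn : IsSeminormal S) {p : ℕ} [hp : Fact p.Prime]
    {u v : Fin n → ℤ} (hu : u ∈ S) (hv : v ∈ S) (hvp : ∀ D, IsPFace S p D → toReal n v ∉ D)
    (huv : ∀ D, IsProperRUF S D → toReal n v ∈ D → toReal n u ∈ D) :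
    ∃ e, 0 < e ∧ CartierRel S p e u v := by
  obtain ⟨N, hN⟩ := exists_forall_mem_cone_of_add_nsmul_mem hfg u
  refine ⟨N + 1, N.succ_pos, fun z hzM hx => ?_⟩
  have hzC : toReal n z ∈ cone S := hN (p ^ (N + 1))
    (N.lt_succ_self.le.trans (Nat.lt_pow_self hp.out.one_lt).le) z (toReal_mem_cone hx)
  -- Induction from larger faces to smaller ones: if `u ∈ G`, then `pᵉ z ∈ M_G` and `G` is not a
  -- `p`-face; if `u ∉ G`, then `G` is relatively saturated and inherits `z` from the faces above
  -- it.
  have key : ∀ G, IsFace S G → toReal n v ∈ G → toReal n z ∈ G → z ∈ faceLattice S G := by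
    intro G hG
    have hwf := (finite_setOf_isFace hfg).wellFoundedOn (r := (· > ·))
    refine hwf.induction (P := fun G => toReal n v ∈ G → toReal n z ∈ G → z ∈ faceLattice S G)
      hG ?_
    intro G hG ih hvG hzG
    have hG : IsFace S G := hG
    by_cases huG : toReal n u ∈ G
    · refine mem_faceLattice_of_pow_nsmul_mem hG (fun h => hvp G h hvG) hzM
        (mem_spanPoints_of_mem hzG) (N + 1) ?_
      have hxG : toReal n (u + p ^ (N + 1) • z) ∈ G := by
        rw [toReal_add_pow_nsmul]
        exact add_mem huG (PointedCone.smul_mem _ (by positivity) hzG)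
      have := sub_mem (mem_faceLattice_of_mem hx hxG) (mem_faceLattice_of_mem hu huG)
      rwa [add_sub_cancel_left] at this
    · have hsat : IsRelativelySaturated S G := by
        by_contra hsat
        exact huG (huv G ⟨⟨hG, Or.inr hsat⟩, fun h => huG (h ▸ toReal_mem_cone hu)⟩ hvG)
      exact isRelativelySaturated_iff.1 hsat z fun G' hG' hlt =>
        ⟨ih G' hG' hlt (hlt.le hvG) (hlt.le hzG), mem_spanPoints_of_mem hzG⟩
  have hG := mem_minFace_add (toReal_mem_cone hv) hzC
  rw [← map_add] at hG
  exact hsn.mem_of_mem_faceLattice (map_add (toReal n) v z ▸ add_mem (toReal_mem_cone hv) hzC)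
    le_rfl (add_mem (mem_faceLattice_of_mem hv hG.1) (key _ (isFace_minFace _) hG.1 hG.2))

end MonoidCone

/-! ### Composition of `p⁻ᵉ`-linear maps -/

namespace Cartier

variable {p : ℕ} [Fact p.Prime] {R : Type*} [CommRing R] [CharP R p]

theorem map_pow_mul {e : ℕ} (φ : FrobeniusPush p e R →ₗ[R] R) (r x : R) :
    φ (r ^ p ^ e * x : R) = r * φ x := φ.map_smul r x

/-- The composition of a `p⁻ᵉ`-linear map with a `p⁻ᵈ`-linear map. -/
def comp {d e : ℕ} (φ : FrobeniusPush p e R →ₗ[R] R) (ψ : FrobeniusPush p d R →ₗ[R] R) :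
    FrobeniusPush p (d + e) R →ₗ[R] R where
  toFun x := φ (ψ x : R)
  map_add' x y := by
    have h : ψ ((x : R) + (y : R) : R) = ψ x + ψ y := ψ.map_add x y
    exact (congrArg (fun t : R => φ t) h).trans (φ.map_add _ _)
  map_smul' r x := by
    have h' : ∀ x : R, ψ (r ^ p ^ (d + e) * x : R) = r ^ p ^ e * ψ x := fun x => by
      rw [add_comm d e, pow_add, pow_mul]; exact map_pow_mul ψ _ x
    have h := h' x
    exact (congrArg (fun t : R => φ t) h).trans (map_pow_mul φ r _)

/-- An induction principle for sums of images of an ideal under `p⁻ᵉ`-linear maps. -/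
theorem iSup_map_induction {P : ℕ → Prop} {I : Ideal R} {motive : R → Prop} {x : R}
    (hx : x ∈ ⨆ (e : ℕ) (_ : P e) (φ : FrobeniusPush p e R →ₗ[R] R), (pushIdeal p e I).map φ)
    (mem : ∀ e, P e → ∀ (φ : FrobeniusPush p e R →ₗ[R] R), ∀ y ∈ I, motive (φ y))
    (zero : motive 0) (add : ∀ x y, motive x → motive y → motive (x + y)) : motive x := by
  refine Submodule.iSup_induction _ (motive := motive) hx (fun e x hx => ?_) zero add
  refine Submodule.iSup_induction _ (motive := motive) hx (fun he x hx => ?_) zero add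
  refine Submodule.iSup_induction _ (motive := motive) hx (fun φ x hx => ?_) zero add
  obtain ⟨y, hy, rfl⟩ := hx
  exact mem e he φ y hy

theorem map_mem_iSup {P : ℕ → Prop} {I : Ideal R} {e : ℕ} (he : P e)
    (φ : FrobeniusPush p e R →ₗ[R] R) {y : R} (hy : y ∈ I) :
    (φ y : R) ∈ ⨆ (e : ℕ) (_ : P e) (φ : FrobeniusPush p e R →ₗ[R] R), (pushIdeal p e I).map φ :=
  Submodule.mem_iSup_of_mem e <| Submodule.mem_iSup_of_mem he <| Submodule.mem_iSup_of_mem φ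
    ⟨y, hy, rfl⟩

theorem IsFixed.map_mem {I : Ideal R} (hI : IsFixed p I) {e : ℕ} (he : 0 < e)
    (φ : FrobeniusPush p e R →ₗ[R] R) {y : R} (hy : y ∈ I) : (φ y : R) ∈ I := by
  unfold IsFixed at hI
  have := map_mem_iSup (P := fun e => 0 < e) he φ hy
  rwa [← hI] at this

/-- A fixed ideal is already the sum of its images under `p⁻ᵉ`-linear maps with `e ≥ N`. -/
theorem IsFixed.le_iSup {I : Ideal R} (hI : IsFixed p I) (N : ℕ) :
    I ≤ ⨆ (e : ℕ) (_ : N ≤ e) (φ : FrobeniusPush p e R →ₗ[R] R), (pushIdeal p e I).map φ := by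
  induction N with
  | zero =>
    intro x hx
    rw [hI] at hx
    exact iSup_map_induction hx (fun e _ φ y hy => map_mem_iSup (Nat.zero_le e) φ hy)
      (zero_mem _) fun _ _ => add_mem
  | succ N ih =>
    intro x hx
    rw [hI] at hx
    refine iSup_map_induction hx (fun e he φ y hy => ?_) (zero_mem _) fun _ _ => add_mem
    -- Each `y ∈ I` is a sum of images with exponent `d ≥ N`; composing with `φ` raises the exponent
    -- to `d + e ≥ N + 1`.
    refine iSup_map_induction (motive := fun y : R => (φ y : R) ∈ _) (ih hy)
      (fun d hd ψ z hz => ?_) ?_ fun a b ha hb => ?_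
    · exact map_mem_iSup (by omega : N + 1 ≤ d + e) (comp φ ψ) hz
    · rw [show φ (0 : R) = 0 from φ.map_zero]; exact zero_mem _
    · rw [show φ (a + b : R) = φ a + φ b from φ.map_add a b]; exact add_mem ha hb

end Cartier

/-! ### Homogeneous `p⁻ᵉ`-linear maps on `k[S]` -/

namespace MonoidCone

open Cartier

variable {n : ℕ} {S : AddSubmonoid (Fin n → ℤ)} {k : Type*} [Field k]

theorem exists_sub_of_mem_lattice {z : Fin n → ℤ} (hz : z ∈ lattice S) :
    ∃ s ∈ S, ∃ t ∈ S, z = s - t := by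
  induction hz using AddSubgroup.closure_induction with
  | mem x hx => exact ⟨x, hx, 0, zero_mem _, by simp⟩
  | zero => exact ⟨0, zero_mem _, 0, zero_mem _, by simp⟩
  | add x y _ _ hx hy =>
    obtain ⟨s, hs, t, ht, rfl⟩ := hx
    obtain ⟨s', hs', t', ht', rfl⟩ := hy
    exact ⟨s + s', add_mem hs hs', t + t', add_mem ht ht', by abel⟩
  | neg x _ hx =>
    obtain ⟨s, hs, t, ht, rfl⟩ := hx
    exact ⟨t, ht, s, hs, by abel⟩

variable {p : ℕ} [hp : Fact p.Prime] [CharP k p] {e : ℕ}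

/-- With `z = s - t`, linearity gives `x^s φ(c x^u) = x^t φ(c x^(u + pᵉ z))`. The coefficient at `s
+ v` is nonzero, so `s + v ∈ t + S`. -/
theorem cartierRel_of_coeff_single_ne_zero
    (φ : FrobeniusPush p e (AddMonoidAlgebra k S) →ₗ[AddMonoidAlgebra k S] AddMonoidAlgebra k S)
    {u v : S} {c : k}
    (h : (φ (AddMonoidAlgebra.single u c : AddMonoidAlgebra k S)).coeff v ≠ 0) :
    CartierRel S p e u v := by
  intro z hz hx
  obtain ⟨s, hs, t, ht, rfl⟩ := exists_sub_of_mem_lattice hz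
  have hmul : ∀ (s u : S) (c : k), (AddMonoidAlgebra.single s (1 : k)) ^ p ^ e *
      AddMonoidAlgebra.single u c = AddMonoidAlgebra.single (p ^ e • s + u) c := by
    intro s u c
    rw [AddMonoidAlgebra.single_pow, AddMonoidAlgebra.single_mul_single, one_pow, one_mul]
  have heq : p ^ e • (⟨s, hs⟩ : S) + u = p ^ e • (⟨t, ht⟩ : S) + ⟨_, hx⟩ := by
    apply Subtype.ext
    push_cast
    rw [smul_sub]; abel
  have h1 := map_pow_mul φ (AddMonoidAlgebra.single ⟨s, hs⟩ 1) (AddMonoidAlgebra.single u c)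
  have h2 := map_pow_mul φ (AddMonoidAlgebra.single ⟨t, ht⟩ 1) (AddMonoidAlgebra.single ⟨_, hx⟩ c)
  rw [hmul] at h1 h2
  rw [heq, h2] at h1
  replace h1 := h1.symm
  have h3 := congrArg (fun f : AddMonoidAlgebra k S => f.coeff (⟨s, hs⟩ + v)) h1
  beta_reduce at h3
  rw [AddMonoidAlgebra.coeff_single_mul_eq_mul_coeff v (fun _ _ => by
    rw [add_right_inj]), one_mul] at h3
  by_contra hne
  rw [AddMonoidAlgebra.coeff_single_mul_of_forall_add_ne] at h3
  · exact h h3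
  · intro d hd
    have hd' : t + (d : Fin n → ℤ) = s + (v : Fin n → ℤ) := congrArg Subtype.val hd
    refine hne ?_
    have : (v : Fin n → ℤ) + (s - t) = d := by rw [← add_sub_assoc, add_comm, ← hd']; abel
    rw [this]; exact d.2

theorem exists_cartierRel_of_mem_support
    (φ : FrobeniusPush p e (AddMonoidAlgebra k S) →ₗ[AddMonoidAlgebra k S] AddMonoidAlgebra k S)
    {h : AddMonoidAlgebra k S} {v : S} (hv : v ∈ (φ h).coeff.support) :
    ∃ u ∈ h.coeff.support, CartierRel S p e u v := by
  have hsum : φ h = ∑ u ∈ h.coeff.support,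
      φ (AddMonoidAlgebra.single u (h.coeff u) : AddMonoidAlgebra k S) := by
    conv_lhs => rw [← h.sum_coeff_single]
    exact map_sum φ (fun u => (AddMonoidAlgebra.single u (h.coeff u) : AddMonoidAlgebra k S)) _
  rw [hsum, Finsupp.mem_support_iff, AddMonoidAlgebra.coeff_sum, Finsupp.finsetSum_apply] at hv
  obtain ⟨u, hu, hne⟩ := Finset.exists_ne_zero_of_sum_ne_zero hv
  exact ⟨u, hu, cartierRel_of_coeff_single_ne_zero φ hne⟩

/-- The homogeneous `p⁻ᵉ`-linear map on `k[S]` sending `x^u` to `x^v`. -/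
theorem exists_linearMap_of_cartierRel [PerfectRing k p] {u v : S} (h : CartierRel S p e u v) :
    ∃ ψ : FrobeniusPush p e (AddMonoidAlgebra k S) →ₗ[AddMonoidAlgebra k S] AddMonoidAlgebra k S,
      (∀ c : k, ψ (AddMonoidAlgebra.single u c : AddMonoidAlgebra k S) =
        AddMonoidAlgebra.single v ((iterateFrobeniusEquiv k p e).symm c)) ∧
      ∀ (w : S) (c : k), (¬ ∃ z ∈ lattice S, (w : Fin n → ℤ) = u + p ^ e • z) →
        ψ (AddMonoidAlgebra.single w c : AddMonoidAlgebra k S) = 0 := by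
  classical
  have hpe : p ^ e ≠ 0 := pow_ne_zero e hp.out.ne_zero
  have hcancel : ∀ z z' : Fin n → ℤ, p ^ e • z = p ^ e • z' → z = z' := fun z z' h =>
    nsmul_right_injective hpe h
  let σ : k →+ k := ((iterateFrobeniusEquiv k p e).symm : k →+* k).toAddMonoidHom
  -- The term `c x^(u + pᵉ z)` goes to `c^(1/pᵉ) x^(v + z)`, other exponents to zero; `z` is unique
  -- because `ℤⁿ` is torsion-free.
  let base : S → k →+ AddMonoidAlgebra k S := fun w =>
    if hw : ∃ z ∈ lattice S, (w : Fin n → ℤ) = u + p ^ e • z then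
      (AddMonoidAlgebra.singleAddHom (⟨v + hw.choose, h _ hw.choose_spec.1
        (hw.choose_spec.2 ▸ w.2)⟩ : S)).comp σ
    else 0
  have hbase : ∀ (w w' : S) (z : Fin n → ℤ), z ∈ lattice S → (w : Fin n → ℤ) = u + p ^ e • z →
      (w' : Fin n → ℤ) = v + z → ∀ c, base w c = AddMonoidAlgebra.single w' (σ c) := by
    intro w w' z hz hw hw' c
    have hex : ∃ z ∈ lattice S, (w : Fin n → ℤ) = u + p ^ e • z := ⟨z, hz, hw⟩
    have hzz : hex.choose = z := hcancel _ _ (add_left_cancel (hex.choose_spec.2.symm.trans hw))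
    simp only [base, dif_pos hex]
    change AddMonoidAlgebra.single _ _ = _
    congr 1
    exact Subtype.ext (by rw [hw', ← hzz])
  have hbase0 : ∀ (w : S), (¬ ∃ z ∈ lattice S, (w : Fin n → ℤ) = u + p ^ e • z) →
      ∀ c, base w c = 0 := by
    intro w hw c
    simp only [base, dif_neg hw]
    rfl
  let ψ₀ : AddMonoidAlgebra k S →+ AddMonoidAlgebra k S :=
    (Finsupp.liftAddHom base).comp AddMonoidAlgebra.coeffAddEquiv.toAddMonoidHom
  have hψ₀ : ∀ w c, ψ₀ (AddMonoidAlgebra.single w c) = base w c := fun w c =>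
    Finsupp.liftAddHom_apply_single base w c
  have hsingle : ∀ (s w : S) (b c : k),
      ψ₀ (AddMonoidAlgebra.single s b ^ p ^ e * AddMonoidAlgebra.single w c) =
        AddMonoidAlgebra.single s b * ψ₀ (AddMonoidAlgebra.single w c) := by
    intro s w b c
    rw [AddMonoidAlgebra.single_pow, AddMonoidAlgebra.single_mul_single, hψ₀, hψ₀]
    by_cases hw : ∃ z ∈ lattice S, (w : Fin n → ℤ) = u + p ^ e • z
    · obtain ⟨z, hz, hw⟩ := hw
      have hvz : (v : Fin n → ℤ) + z ∈ S := h z hz (hw ▸ w.2)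
      rw [hbase w ⟨_, hvz⟩ z hz hw rfl, hbase (p ^ e • s + w) (s + ⟨_, hvz⟩) (s + z)
        (add_mem (le_lattice _ s.2) hz) (by push_cast; rw [hw, smul_add]; abel)
        (by push_cast; abel), AddMonoidAlgebra.single_mul_single]
      congr 1
      have : σ (b ^ p ^ e) = b := (iterateFrobeniusEquiv k p e).symm_apply_apply b
      exact (map_mul (iterateFrobeniusEquiv k p e).symm _ _).trans (congrArg (· * σ c) this)
    · rw [hbase0 w hw, mul_zero, hbase0]
      rintro ⟨z, hz, hw'⟩
      refine hw ⟨z - s, sub_mem hz (le_lattice _ s.2), ?_⟩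
      push_cast at hw'
      rw [smul_sub, ← add_sub_assoc, ← hw']; abel
  have hlin : ∀ r x : AddMonoidAlgebra k S, ψ₀ (r ^ p ^ e * x) = r * ψ₀ x := by
    intro r x
    induction x using AddMonoidAlgebra.induction_linear with
    | zero => rw [mul_zero, map_zero, mul_zero]
    | add x y hx hy => rw [mul_add, map_add, map_add, hx, hy, mul_add]
    | single w c =>
      induction r using AddMonoidAlgebra.induction_linear with
      | zero => rw [zero_pow hpe, zero_mul, map_zero, zero_mul]
      | add r r' hr hr' => rw [add_pow_char_pow, add_mul, map_add, hr, hr', add_mul]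
      | single s b => exact hsingle s w b c
  refine ⟨{ toFun := ψ₀, map_add' := map_add ψ₀, map_smul' := hlin }, fun c => ?_, fun w c hw => ?_⟩
  · exact (hψ₀ u c).trans (hbase u v 0 (zero_mem _) (by simp) (by simp) c)
  · exact (hψ₀ w c).trans (hbase0 w hw c)

end MonoidCone

/-! ### Fixed ideals are monomial -/

namespace MonoidCone

open Cartier

variable {n : ℕ} {S : AddSubmonoid (Fin n → ℤ)} {k : Type*} [Field k]

/-- The monomials `x^v` occurring in elements of an ideal generated by the monomials with exponents
in an `S`-closed set `V` are those with `v ∈ V`. -/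
theorem mem_span_single_image {V : Set S} (hV : ∀ v ∈ V, ∀ s, s + v ∈ V)
    {f : AddMonoidAlgebra k S} :
    f ∈ Ideal.span ((fun u : S => AddMonoidAlgebra.single u (1 : k)) '' V) ↔
      ∀ v ∈ f.coeff.support, v ∈ V := by
  refine AddMonoidAlgebra.mem_ideal_span_of'_image.trans
    ⟨fun h v hv => ?_, fun h v hv => ⟨v, h v hv, 0, (zero_add v).symm⟩⟩
  obtain ⟨w, hw, d, rfl⟩ := h v hv
  exact hV w hw d

theorem single_mem_span_single_image {V : Set S} (hV : ∀ v ∈ V, ∀ s, s + v ∈ V) {v : S} :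
    AddMonoidAlgebra.single v (1 : k) ∈
      Ideal.span ((fun u : S => AddMonoidAlgebra.single u (1 : k)) '' V) ↔ v ∈ V := by
  rw [mem_span_single_image hV]
  constructor
  · exact fun h => h v (by simp)
  · intro h w hw
    rw [AddMonoidAlgebra.coeff_single] at hw
    rwa [Finset.mem_singleton.1 (Finsupp.support_single_subset hw)]

theorem single_add_mem {I : Ideal (AddMonoidAlgebra k S)} {v : S} {c d : k}
    (h : AddMonoidAlgebra.single v c ∈ I) (s : S) :
    AddMonoidAlgebra.single (s + v) (d * c) ∈ I := by
  rw [← AddMonoidAlgebra.single_mul_single]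
  exact I.mul_mem_left _ h

theorem single_one_add_mem {I : Ideal (AddMonoidAlgebra k S)} {v : S}
    (h : AddMonoidAlgebra.single v (1 : k) ∈ I) (s : S) :
    AddMonoidAlgebra.single (s + v) (1 : k) ∈ I := by
  simpa using single_add_mem (d := 1) h s

theorem CartierRel.add_right {p e : ℕ} {u v s : Fin n → ℤ} (h : CartierRel S p e u v) (hs : s ∈ S) :
    CartierRel S p e u (s + v) := fun z hz hx => by
  rw [add_assoc]; exact add_mem hs (h z hz hx)

/-- The exponents of finitely many elements of `k[S]` are separated by all large powers of `p`. -/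
theorem exists_pow_separating {p : ℕ} (hp : p.Prime) (F : Finset (AddMonoidAlgebra k S)) :
    ∃ N, 0 < N ∧ ∀ e, N ≤ e → ∀ f ∈ F, ∀ u ∈ f.coeff.support, ∀ u' ∈ f.coeff.support,
      ∀ z : Fin n → ℤ, (u' : Fin n → ℤ) = u + p ^ e • z → u' = u := by
  set B : ℕ := ∑ f ∈ F, ∑ u ∈ f.coeff.support, ∑ j, ((u : Fin n → ℤ) j).natAbs with hB
  have hbound : ∀ f ∈ F, ∀ u ∈ f.coeff.support, ∀ j, ((u : Fin n → ℤ) j).natAbs ≤ B := by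
    intro f hf u hu j
    refine (Finset.single_le_sum (f := fun j => ((u : Fin n → ℤ) j).natAbs)
      (fun _ _ => Nat.zero_le _) (Finset.mem_univ j)).trans ?_
    refine (Finset.single_le_sum (f := fun u : S => ∑ j, ((u : Fin n → ℤ) j).natAbs)
      (fun _ _ => Nat.zero_le _) hu).trans ?_
    exact Finset.single_le_sum
      (f := fun f : AddMonoidAlgebra k S => ∑ u ∈ f.coeff.support, ∑ j, ((u : Fin n → ℤ) j).natAbs)
      (fun _ _ => Nat.zero_le _) hf
  refine ⟨2 * B + 1, by omega, fun e he f hf u hu u' hu' z hz => Subtype.ext ?_⟩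
  have hlt : 2 * B < p ^ e := (by omega : 2 * B < e).trans (Nat.lt_pow_self hp.one_lt)
  ext j
  have h1 := hbound f hf u hu j
  have h2 := hbound f hf u' hu' j
  have h3 : (u' : Fin n → ℤ) j = (u : Fin n → ℤ) j + ((p ^ e : ℕ) : ℤ) * z j := by
    rw [hz]; simp
  have h4 : ((u' : Fin n → ℤ) j - (u : Fin n → ℤ) j) = 0 := by
    refine Int.eq_zero_of_abs_lt_dvd (m := ((p ^ e : ℕ) : ℤ)) ⟨z j, by rw [h3]; ring⟩ ?_
    rw [abs_lt]
    constructor <;> omega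
  omega

variable {p : ℕ} [hp : Fact p.Prime] [CharP k p]

theorem _root_.Cartier.IsFixed.single_mem_of_cartierRel [PerfectRing k p]
    {I : Ideal (AddMonoidAlgebra k S)} (hI : IsFixed p I) {e : ℕ} (he : 0 < e) {u v : S}
    (h : CartierRel S p e u v) (hu : AddMonoidAlgebra.single u (1 : k) ∈ I) :
    AddMonoidAlgebra.single v (1 : k) ∈ I := by
  obtain ⟨ψ, hψ, -⟩ := exists_linearMap_of_cartierRel (k := k) h
  have := hI.map_mem he ψ hu
  rwa [hψ, map_one] at this

/-- Ideals fixed by the Cartier algebra are monomial. -/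
theorem _root_.Cartier.IsFixed.single_mem_of_mem_support [PerfectRing k p] (hfg : S.FG)
    {I : Ideal (AddMonoidAlgebra k S)} (hI : IsFixed p I) {f : AddMonoidAlgebra k S} (hf : f ∈ I)
    {v : S} (hv : v ∈ f.coeff.support) : AddMonoidAlgebra.single v (1 : k) ∈ I := by
  set V : Set S := {v | AddMonoidAlgebra.single v (1 : k) ∈ I} with hVdef
  have hV : ∀ v ∈ V, ∀ s, s + v ∈ V := fun _ hv s => single_one_add_mem hv s
  suffices h : I ≤ Ideal.span ((fun u : S => AddMonoidAlgebra.single u (1 : k)) '' V) from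
    (mem_span_single_image hV).1 (h hf) v hv
  have : AddMonoid.FG S := (AddMonoid.fg_iff_addSubmonoid_fg S).2 hfg
  have : IsNoetherianRing (AddMonoidAlgebra k S) := Algebra.FiniteType.isNoetherianRing k _
  obtain ⟨F, hF⟩ : I.FG := IsNoetherian.noetherian I
  obtain ⟨N, hN, hsep⟩ := exists_pow_separating hp.out F
  intro x hx
  refine iSup_map_induction (hI.le_iSup N hx) (fun e he φ h hh => ?_) (zero_mem _)
    fun _ _ => add_mem
  have hh' : h ∈ Ideal.span (F : Set (AddMonoidAlgebra k S)) := hF.symm ▸ hh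
  refine Submodule.closure_induction (p := fun y _ => (φ (show AddMonoidAlgebra k S from y) :
    AddMonoidAlgebra k S) ∈ _) ?_ (fun a b _ _ ha hb => ?_) (fun r f hf => ?_) hh'
  · exact (map_zero φ).symm ▸ zero_mem _
  · exact (map_add φ (show AddMonoidAlgebra k S from a) b).symm ▸ add_mem ha hb
  · induction r using AddMonoidAlgebra.induction_linear with
    | zero => rw [zero_smul]; exact (map_zero φ).symm ▸ zero_mem _
    | add a b ha hb =>
      rw [add_smul]
      exact (map_add φ (a • f : AddMonoidAlgebra k S) (b • f)).symm ▸ add_mem ha hb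
    | single w c =>
      refine (mem_span_single_image hV).2 fun v hv => ?_
      obtain ⟨u', hu', hrel⟩ := exists_cartierRel_of_mem_support φ hv
      have hu'' : ∃ u ∈ f.coeff.support, u' = w + u := by
        by_contra hne
        push Not at hne
        rw [Finsupp.mem_support_iff] at hu'
        refine hu' ?_
        rw [smul_eq_mul, ← f.sum_coeff_single, Finsupp.sum, Finset.mul_sum,
          AddMonoidAlgebra.coeff_sum, Finsupp.finsetSum_apply]
        refine Finset.sum_eq_zero fun u hu => ?_
        rw [AddMonoidAlgebra.single_mul_single, AddMonoidAlgebra.coeff_single,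
          Finsupp.single_eq_of_ne (hne u hu)]
      obtain ⟨u, hu, rfl⟩ := hu''
      -- The map `ψ` sees only exponents congruent to `w + u` modulo `pᵉ M`. By separation it kills
      -- every other term of `x^w f`, leaving a nonzero multiple of `x^v` in `I`.
      obtain ⟨ψ, hψ, hψ0⟩ := exists_linearMap_of_cartierRel (k := k) hrel
      have hmem : (ψ (AddMonoidAlgebra.single w (1 : k) * f : AddMonoidAlgebra k S) :
          AddMonoidAlgebra k S) ∈ I :=
        hI.map_mem (hN.trans_le he) ψ (I.mul_mem_left _ (hF ▸ Ideal.subset_span hf))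
      have hsum : (ψ (AddMonoidAlgebra.single w (1 : k) * f : AddMonoidAlgebra k S) :
          AddMonoidAlgebra k S) =
          AddMonoidAlgebra.single v ((iterateFrobeniusEquiv k p e).symm (f.coeff u)) := by
        have h1 : AddMonoidAlgebra.single w (1 : k) * f = ∑ u ∈ f.coeff.support,
            AddMonoidAlgebra.single (w + u) (f.coeff u) := by
          conv_lhs => rw [← f.sum_coeff_single, Finsupp.sum, Finset.mul_sum]
          simp only [AddMonoidAlgebra.single_mul_single, one_mul]
        rw [h1, ← hψ]
        refine (map_sum ψ (fun u => (AddMonoidAlgebra.single (w + u) (f.coeff u) :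
          AddMonoidAlgebra k S)) _).trans (Finset.sum_eq_single u (fun u₂ hu₂ hne => ?_)
          fun h => absurd hu h)
        refine hψ0 _ _ ?_
        rintro ⟨z, -, hz⟩
        refine hne (hsep e he f hf u hu u₂ hu₂ z ?_)
        push_cast at hz
        rw [add_assoc] at hz
        exact add_left_cancel hz
      rw [hsum] at hmem
      have hne : (iterateFrobeniusEquiv k p e).symm (f.coeff u) ≠ 0 := by
        rw [Ne, map_eq_zero_iff _ (RingEquiv.injective _)]
        exact Finsupp.mem_support_iff.1 hu
      have := single_add_mem (d := ((iterateFrobeniusEquiv k p e).symm (f.coeff u))⁻¹) hmem 0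
      rwa [zero_add, inv_mul_cancel₀ hne] at this

theorem _root_.Cartier.IsFixed.eq_span_single_image [PerfectRing k p] (hfg : S.FG)
    {I : Ideal (AddMonoidAlgebra k S)} (hI : IsFixed p I) :
    I = Ideal.span ((fun u : S => AddMonoidAlgebra.single u (1 : k)) ''
      {v | AddMonoidAlgebra.single v (1 : k) ∈ I}) := by
  apply le_antisymm
  · intro f hf
    exact (mem_span_single_image fun v hv s => single_one_add_mem hv s).2 fun v hv =>
      hI.single_mem_of_mem_support hfg hf hv
  · rw [Ideal.span_le]
    rintro _ ⟨u, hu, rfl⟩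
    exact hu

/-- The exponents reachable from `I` form an `S`-closed set, and the monomial ideal they span
contains every `φ(F^e_* I)` with `e > 0`, hence `I`. -/
theorem _root_.Cartier.IsFixed.exists_cartierRel {I : Ideal (AddMonoidAlgebra k S)}
    [PerfectRing k p] (hfg : S.FG) (hI : IsFixed p I) {v : S}
    (hv : AddMonoidAlgebra.single v (1 : k) ∈ I) :
    ∃ u : S, AddMonoidAlgebra.single u (1 : k) ∈ I ∧ ∃ e, 0 < e ∧ CartierRel S p e u v := by
  set W : Set S := {v | ∃ u : S, AddMonoidAlgebra.single u (1 : k) ∈ I ∧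
    ∃ e, 0 < e ∧ CartierRel S p e u v}
  have hW : ∀ v ∈ W, ∀ s, s + v ∈ W := by
    rintro v ⟨u, hu, e, he, h⟩ s
    exact ⟨u, hu, e, he, h.add_right s.2⟩
  change v ∈ W
  rw [← single_mem_span_single_image (k := k) hW]
  have hv' := hI.le_iSup 1 hv
  refine iSup_map_induction hv' (fun e he φ h hh => ?_) (zero_mem _) fun _ _ => add_mem
  refine (mem_span_single_image hW).2 fun w hw => ?_
  obtain ⟨u, hu, hrel⟩ := exists_cartierRel_of_mem_support φ hw
  exact ⟨u, hI.single_mem_of_mem_support hfg hh hu, e, he, hrel⟩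

/-- A combinatorial criterion for a monomial ideal to be fixed by the Cartier algebra. -/
theorem isFixed_span_single_image [PerfectRing k p] {V : Set S} (hV : ∀ v ∈ V, ∀ s, s + v ∈ V)
    (hle : ∀ u ∈ V, ∀ (v : S) (e : ℕ), 0 < e → CartierRel S p e u v → v ∈ V)
    (hge : ∀ v ∈ V, ∃ u ∈ V, ∃ e, 0 < e ∧ CartierRel S p e (u : Fin n → ℤ) v) :
    IsFixed p (Ideal.span ((fun u : S => AddMonoidAlgebra.single u (1 : k)) '' V)) := by
  apply le_antisymm
  · rw [Ideal.span_le]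
    rintro _ ⟨v, hv, rfl⟩
    obtain ⟨u, hu, e, he, hrel⟩ := hge v hv
    obtain ⟨ψ, hψ, -⟩ := exists_linearMap_of_cartierRel (k := k) hrel
    have := map_mem_iSup (P := fun e => 0 < e) he ψ
      ((single_mem_span_single_image (k := k) hV).2 hu)
    rwa [hψ, map_one] at this
  · intro f hf
    refine iSup_map_induction hf (fun e he φ h hh => ?_) (zero_mem _) fun _ _ => add_mem
    refine (mem_span_single_image hV).2 fun v hv => ?_
    obtain ⟨u, hu, hrel⟩ := exists_cartierRel_of_mem_support φ hv
    exact hle u ((mem_span_single_image hV).1 hh u hu) v e he hrel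

/-! ### Classification by unions of faces -/

theorem unionIdeal_eq_span {m : ℕ} (D : Fin m → PointedCone ℝ (Fin n → ℝ)) :
    unionIdeal S k D = Ideal.span ((fun u : S => AddMonoidAlgebra.single u (1 : k)) ''
      {u | ∀ i, toReal n (u : Fin n → ℤ) ∉ D i}) := by
  unfold unionIdeal
  congr 1
  ext f
  exact exists_congr fun u => and_congr_right fun _ => eq_comm

/-- The relation cannot move an exponent into an intersection of proper RUFs from outside. Exponents
off the maximal pRUFs are off all `p`-faces, hence related to themselves. -/
theorem isFixed_unionIdeal [PerfectRing k p] (hfg : S.FG) (hsn : IsSeminormal S) {m : ℕ}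
    (D : Fin m → PointedCone ℝ (Fin n → ℝ)) (hface : ∀ i, IsFace S (D i))
    (hint : ∀ i, IsIntersectionOfProperRUFs S (D i))
    (hmax : ∀ E, IsMaximalPRUF S p E → ∃ i, D i = E) : IsFixed p (unionIdeal S k D) := by
  rw [unionIdeal_eq_span]
  refine isFixed_span_single_image ?_ ?_ ?_
  · intro v hv s i hi
    refine hv i (PointedCone.IsFaceOf.mem_of_add_mem_right (hface i) (toReal_mem_cone s.2)
      (toReal_mem_cone v.2) ?_)
    rw [← map_add]; exact hi
  · intro u hu v e _ hrel i hvi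
    obtain ⟨T, hT, hD⟩ := hint i
    refine hu i ?_
    rw [hD] at hvi ⊢
    refine ⟨toReal_mem_cone u.2, Submodule.mem_sInf.2 fun E hE => ?_⟩
    exact hrel.mem_of_isProperRUF hfg hsn u.2 v.2 (hT E hE) (Submodule.mem_sInf.1 hvi.2 E hE)
  · intro v hv
    refine ⟨v, hv, 1, one_pos, cartierRel_self hsn v.2 fun E hE hvE => ?_⟩
    obtain ⟨G, hG, hEG⟩ := hE.exists_le_isPRUF hfg
    obtain ⟨G', hG', hGG'⟩ := hG.exists_le_isMaximalPRUF hfg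
    obtain ⟨i, rfl⟩ := hmax G' hG'
    exact hv i (hGG' (hEG hvE))

/-- The intersection of all proper relatively unsaturated faces containing a point. -/
def rufHull (S : AddSubmonoid (Fin n → ℤ)) (x : Fin n → ℝ) : PointedCone ℝ (Fin n → ℝ) :=
  cone S ⊓ sInf {E | IsProperRUF S E ∧ x ∈ E}

theorem isFace_rufHull (x : Fin n → ℝ) : IsFace S (rufHull S x) :=
  PointedCone.IsFaceOf.sInf _ fun _ hE => hE.1.1.1

theorem IsProperRUF.isIntersectionOfProperRUFs {D : PointedCone ℝ (Fin n → ℝ)}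
    (hD : IsProperRUF S D) : IsIntersectionOfProperRUFs S D :=
  ⟨{D}, by rintro _ rfl; exact hD, by rw [sInf_singleton, inf_eq_right.2 hD.1.1.le]⟩

theorem _root_.Cartier.IsFixed.exists_eq_unionIdeal [PerfectRing k p] (hfg : S.FG)
    (hsn : IsSeminormal S) {I : Ideal (AddMonoidAlgebra k S)} (hI : IsFixed p I) :
    ∃ (m : ℕ) (D : Fin m → PointedCone ℝ (Fin n → ℝ)), (∀ i, IsFace S (D i)) ∧
      (∀ i, IsIntersectionOfProperRUFs S (D i)) ∧
      (∀ E, IsMaximalPRUF S p E → ∃ i, D i = E) ∧ I = unionIdeal S k D := by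
  -- The RUF hulls of the missing exponents cover the complement of `I`; the maximal pRUFs are added
  -- to meet the second condition.
  set 𝒟 : Set (PointedCone ℝ (Fin n → ℝ)) := {D | IsMaximalPRUF S p D ∨
    ∃ v : S, AddMonoidAlgebra.single v (1 : k) ∉ I ∧ D = rufHull S (toReal n v)} with h𝒟
  have hface : ∀ D ∈ 𝒟, IsFace S D := by
    rintro D (hD | ⟨v, -, rfl⟩)
    · exact hD.prop.1.1
    · exact isFace_rufHull _
  have hfin : 𝒟.Finite := (finite_setOf_isFace hfg).subset hface
  have hnot : ∀ (v : S) (E : PointedCone ℝ (Fin n → ℝ)), AddMonoidAlgebra.single v (1 : k) ∈ I →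
      IsPRUF S p E → toReal n v ∉ E := fun v E hv hE => by
    obtain ⟨u, -, e, he, hrel⟩ := hI.exists_cartierRel hfg hv
    exact hrel.notMem_of_isPRUF hfg hsn he u.2 v.2 hE
  obtain ⟨m, D, -, hD⟩ := hfin.fin_param
  have hmem : ∀ i, D i ∈ 𝒟 := fun i => hD ▸ Set.mem_range_self i
  have hex : ∀ E ∈ 𝒟, ∃ i, D i = E := fun E hE => by rwa [← hD] at hE
  refine ⟨m, D, fun i => hface _ (hmem i), fun i => ?_, fun E hE => hex E (Or.inl hE), ?_⟩
  · rcases hmem i with h | ⟨v, -, h⟩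
    · exact h.prop.isProperRUF.isIntersectionOfProperRUFs
    · exact ⟨_, fun _ hE => hE.1, h⟩
  · rw [unionIdeal_eq_span]
    conv_lhs => rw [hI.eq_span_single_image hfg]
    congr 2
    ext u
    constructor
    · intro hu i hui
      rcases hmem i with h | ⟨v, hv, h⟩
      · exact hnot u _ hu h.prop hui
      · rw [h] at hui
        have huv : ∀ E, IsProperRUF S E → toReal n (v : Fin n → ℤ) ∈ E →
            toReal n (u : Fin n → ℤ) ∈ E :=
          fun E hE hvE => Submodule.mem_sInf.1 hui.2 E ⟨hE, hvE⟩
        -- A `p`-face through `v` lies in a pRUF, which then contains `u`, impossible for `x^u ∈ I`.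
        -- So `u` is related to `v`, contradicting `x^v ∉ I`.
        obtain ⟨e, he, hrel⟩ := MonoidCone.exists_cartierRel (p := p) hfg hsn u.2 v.2
          (fun E hE hvE => by
            obtain ⟨G, hG, hEG⟩ := hE.exists_le_isPRUF hfg
            exact hnot u G hu hG (huv G hG.isProperRUF (hEG hvE))) huv
        exact hv (hI.single_mem_of_cartierRel he hrel hu)
    · intro hu
      by_contra hnu
      obtain ⟨i, hi⟩ := hex _ (Or.inr ⟨u, hnu, rfl⟩)
      refine hu i ?_
      rw [hi]
      exact ⟨toReal_mem_cone u.2, Submodule.mem_sInf.2 fun E hE => hE.2⟩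

end MonoidCone

theorem theorem4 {k : Type*} [Field k] [PerfectField k] (p : ℕ) [Fact p.Prime] [CharP k p]
    {n : ℕ} (S : AddSubmonoid (Fin n → ℤ)) (hfg : S.FG)
    (hpos : MonoidCone.IsPositive S) (hsn : MonoidCone.IsSeminormal S) :
    (∀ I : Ideal (AddMonoidAlgebra k S),
      Cartier.IsFixed p I → MonoidCone.IsMonomialIdeal S I) ∧
    (∀ I : Ideal (AddMonoidAlgebra k S),
      Cartier.IsFixed p I ↔
        ∃ (m : ℕ) (D : Fin m → PointedCone ℝ (Fin n → ℝ)),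
          (∀ i, MonoidCone.IsFace S (D i)) ∧
          (∀ i, MonoidCone.IsIntersectionOfProperRUFs S (D i)) ∧
          (∀ E, MonoidCone.IsMaximalPRUF S p E → ∃ i, D i = E) ∧
          I = MonoidCone.unionIdeal S k D) := by
  refine ⟨fun I hI => ⟨_, hI.eq_span_single_image hfg⟩, fun I =>
    ⟨fun hI => hI.exists_eq_unionIdeal hfg hsn, ?_⟩⟩
  rintro ⟨m, D, hface, hint, hmax, rfl⟩
  exact MonoidCone.isFixed_unionIdeal hfg hsn D hface hint hmax
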